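/- **Setting.** Let $T>0$, $x_0\in\mathbb R^n$, and let $f_1,\dots,f_N:\mathbb R^n\to\mathbb R^n$ and $\ell:\mathbb R^n\to\mathbb R$ be $C^2$ with bounded second derivatives. Put $F(y,v)=\sum_{i=1}^N v_i f_i(y)$. A *non-chattering switching control* is a piecewise constant $u:[0,T]\to\{0,1\}^N$ (finitely many pieces) with $\sum_i u_i(t)=1$ for almost every $t$, whose switching times $\{t\in(0,T): u(t^-)\ne u(t^+)\}$ are pairwise more than some $\delta t>0$ apart. Its *mode schedule* is $([\sigma_1,\dots,\sigma_M],[T_1,\dots,T_{M-1}])$, where $T_1<\dots<T_{M-1}$ are its switching times, $T_0=0$, $T_M=T$, and $u=e_{\sigma_i}$ almost everywhere on $(T_{i-1},T_i)$, with $\sigma_i\neq\sigma_{i+1}$. A *feasible trajectory* is a pair $(x,u)$ with $u$ a non-chattering switching control and $x$ continuous on $[0,T]$ with $x(t)=x_0+\int_0^tF(x(s),u(s))\,ds$ for $t\in[0,T]$; its cost is $J(x,u)=\int_0^T\ell(x(t))\,dt$. Fix a feasible trajectory $(x,u)$. Let $\rho$ be the continuous solution on $[0,T]$ of $\dot\rho=-Df_a(x)^T\rho-D\ell(x)^T$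 on the intervals where $u=e_a$, with $\rho(T)=0$. The *mode insertion gradient* is $d=(d_1,\dots,d_N)$, $d_a(t)=\rho(t)^T\big(f_a(x(t))-F(x(t),u(t))\big)$. Put $\theta=\inf_{a,\;t\in[0,T]}d_a(t)$ and, if $\theta<0$, $\gamma_0=-1/\theta$. Assume that for all $a\ne b$ the function $d_{ab}=d_a-d_b$ has only finitely many critical points in $[0,T]$ (points where it is not differentiable or has zero derivative). For $\mu:[0,T]\to\mathbb R^N$ let $\mathcal Q_i(\mu(t))=\prod_{j\ne i}1(\mu_i(t)-\mu_j(t))$, with $1(r)=1$ for $r\ge 0$ and $1(r)=0$ for $r<0$, and let $\mathcal P(\mu)=(z,\mathcal Q(\mu))$ be the feasible trajectory with control $\mathcal Q(\mu)$ and $z(0)=x_0$. For $\gamma>\gamma_0$ near $\gamma_0$ let $\Sigma=[\sigma_1,\dots,\sigma_M]$ (independent of such $\gamma$) and $[T_1(\gamma),\dots,T_{M-1}(\gamma)]$ be the mode schedule of $\mathcal Q(u-\gamma d)$. The switching time $T_i(\gamma_0^+)$ has *type* $0$ if $T_i(\gamma)$ is constant for $\gamma\in(\gamma_0,\gamma_0+\varepsilon)$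 for some $\varepsilon>0$; otherwise its type is the least $m\ge1$ with $D^md_{\sigma_i\sigma_{i+1}}(T_i(\gamma_0^+)):=\lim_{\gamma\downarrow\gamma_0}D^md_{\sigma_i\sigma_{i+1}}(T_i(\gamma))\neq0$. Let $\overline m$ be the greatest type of the $T_i(\gamma_0^+)$, $i=1,\dots,M-1$ (and $\overline m=0$ if $M=1$). **Corollary (Descent Direction).** If $\theta<0$ and $\overline m\in\{1,2\}$, then $-d$ is a descent direction: there is $\delta\gamma>0$ such that for every $\gamma\in(\gamma_0,\gamma_0+\delta\gamma)$ the projection $\mathcal P(u-\gamma d)$ exists and $$J(\mathcal P(u-\gamma d))<J(x,u).$$ -/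

import Mathlib

open Set Filter Topology MeasureTheory

noncomputable section

namespace SwitchedSystem

/-- The state space `ℝⁿ` with the Euclidean norm. -/
abbrev State (n : ℕ) := EuclideanSpace ℝ (Fin n)

/-- `g` is of class `C²` and the operator norm of its second derivative is bounded. -/
def IsC2Bounded {E V : Type*} [NormedAddCommGroup E] [NormedSpace ℝ E]
    [NormedAddCommGroup V] [NormedSpace ℝ V] (g : E → V) : Prop :=
  ContDiff ℝ 2 g ∧ ∃ K : ℝ, 0 < K ∧ ∀ y, ‖fderiv ℝ (fderiv ℝ g) y‖ ≤ K

/-- The switched vector field `F(y, v) = ∑ᵢ vᵢ fᵢ(y)`. -/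
def vectorField {n N : ℕ} (f : Fin N → State n → State n) (y : State n) (v : Fin N → ℝ) :
    State n :=
  ∑ i, v i • f i y

/-! ### Switching controls and mode schedules -/

/-- `g` is piecewise constant on `[0, T]`: it is locally constant off finitely many times. -/
def IsPiecewiseConstant {α : Type*} (T : ℝ) (g : ℝ → α) : Prop :=
  ∃ S : Set ℝ, S.Finite ∧ ∀ t ∈ Ioo 0 T \ S, ∀ᶠ s in 𝓝 t, g s = g t

/-- A switching control: piecewise constant, with entries in `{0, 1}` that sum to `1`
for almost every time. -/
structure IsSwitchingControl {N : ℕ} (T : ℝ) (u : ℝ → Fin N → ℝ) : Prop where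
  piecewiseConstant : IsPiecewiseConstant T u
  sum_eq_one : ∀ᵐ t : ℝ, t ∈ Icc 0 T → ∑ i, u t i = 1
  zero_or_one : ∀ t ∈ Icc 0 T, ∀ i, u t i = 0 ∨ u t i = 1

/-- The switching times `{t ∈ (0, T) | u(t⁻) ≠ u(t⁺)}` of a piecewise constant `u`. -/
def switchingTimes {N : ℕ} (T : ℝ) (u : ℝ → Fin N → ℝ) : Set ℝ :=
  {t ∈ Ioo 0 T | ∃ v w : Fin N → ℝ, v ≠ w ∧
    (∀ᶠ s in 𝓝[<] t, u s = v) ∧ (∀ᶠ s in 𝓝[>] t, u s = w)}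

/-- The set `Ω`: switching controls for which some `δt > 0` separates any two switching times. -/
def IsNonChatteringControl {N : ℕ} (T : ℝ) (u : ℝ → Fin N → ℝ) : Prop :=
  IsSwitchingControl T u ∧
    ∃ δt : ℝ, 0 < δt ∧
      ∀ s ∈ switchingTimes T u, ∀ t ∈ switchingTimes T u, s ≠ t → δt < |s - t|

/-- For times `τ₀ < ⋯ < τ_{K-1}` in `(0, T)`, the `i`-th of the `K + 1` open intervals into which
they cut `(0, T)`. -/
def modeInterval {K : ℕ} (T : ℝ) (τ : Fin K → ℝ) (i : Fin (K + 1)) : Set ℝ :=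
  {t ∈ Ioo 0 T | (∀ j : Fin K, j.castSucc < i → τ j < t) ∧
    ∀ j : Fin K, i ≤ j.castSucc → t < τ j}

/-- `(σ, τ)` is the mode schedule of the control `u`: `τ` are its switching times, in increasing
order, and `u = e_{σ i}` on the `i`-th interval. The values of `u` at a null set of times (such as
ties in the max-mapping) do not matter. The time `τ i` separates the modes `σ i.castSucc` and
`σ i.succ`. -/
structure IsSchedule {N K : ℕ} (T : ℝ) (u : ℝ → Fin N → ℝ)
    (σ : Fin (K + 1) → Fin N) (τ : Fin K → ℝ) : Prop where
  strictMono : StrictMono τ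
  mem_Ioo : ∀ i, τ i ∈ Ioo 0 T
  modes_ne : ∀ i : Fin K, σ i.castSucc ≠ σ i.succ
  control_eq : ∀ i : Fin (K + 1), ∀ᵐ t : ℝ, t ∈ modeInterval T τ i → u t = Pi.single (σ i) 1

/-! ### Trajectories, cost, adjoint and mode insertion gradient -/

/-- `(x, u)` is a feasible switched system trajectory starting at `x0`: `u ∈ Ω` and `x` is the
(continuous) solution of `ẋ = F(x, u)`, `x(0) = x0`, on `[0, T]`. The integrand is bounded and
piecewise continuous, hence integrable. -/
structure IsFeasible {n N : ℕ} (f : Fin N → State n → State n) (x0 : State n) (T : ℝ)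
    (x : ℝ → State n) (u : ℝ → Fin N → ℝ) : Prop where
  control : IsNonChatteringControl T u
  continuousOn : ContinuousOn x (Icc 0 T)
  state_eq : ∀ t ∈ Icc 0 T, x t = x0 + ∫ s in (0 : ℝ)..t, vectorField f (x s) (u s)

/-- The cost `J(x, u) = ∫₀ᵀ ℓ(x(t)) dt`. -/
def cost {n : ℕ} (ℓ : State n → ℝ) (T : ℝ) (x : ℝ → State n) : ℝ :=
  ∫ t in (0 : ℝ)..T, ℓ (x t)

/-- `ρ` solves the adjoint equation: it is continuous on `[0, T]`, `ρ(T) = 0`, and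
`ρ̇ = -Df_a(x)ᵀ ρ - Dℓ(x)ᵀ` wherever `u` is constantly `e_a` around `t`. -/
structure IsAdjoint {n N : ℕ} (f : Fin N → State n → State n) (ℓ : State n → ℝ) (T : ℝ)
    (x : ℝ → State n) (u : ℝ → Fin N → ℝ) (ρ : ℝ → State n) : Prop where
  continuousOn : ContinuousOn ρ (Icc 0 T)
  final : ρ T = 0
  adjoint_eq : ∀ t ∈ Ioo 0 T, ∀ a : Fin N, (∀ᶠ s in 𝓝 t, u s = Pi.single a 1) →
    HasDerivAt ρ
      (-(ContinuousLinearMap.adjoint (fderiv ℝ (f a) (x t)) (ρ t)) - gradient ℓ (x t)) t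

/-- The mode insertion gradient `d_a(t) = ρ(t)ᵀ (f_a(x(t)) - F(x(t), u(t)))`. -/
def insertionGradient {n N : ℕ} (f : Fin N → State n → State n)
    (x : ℝ → State n) (u : ℝ → Fin N → ℝ) (ρ : ℝ → State n) : ℝ → Fin N → ℝ :=
  fun t a => inner ℝ (ρ t) (f a (x t) - vectorField f (x t) (u t))

/-- The optimality function `θ`: the greatest lower bound of `d_a(t)` over all modes `a` and all
times `t ∈ [0, T]`. -/
def theta {N : ℕ} (T : ℝ) (d : ℝ → Fin N → ℝ) : ℝ :=
  sInf {r | ∃ a : Fin N, ∃ t ∈ Icc 0 T, d t a = r}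

/-- The step size `γ₀ = -1/θ`. -/
def gammaZero {N : ℕ} (T : ℝ) (d : ℝ → Fin N → ℝ) : ℝ := -1 / theta T d

/-- For all `i ≠ j` the curve `v_i - v_j` has finitely many critical points in `[0, T]`, i.e. times
at which it is not differentiable or has zero derivative. -/
def HasFinitelyManyCriticalPoints {N : ℕ} (T : ℝ) (v : ℝ → Fin N → ℝ) : Prop :=
  ∀ i j : Fin N, i ≠ j →
    {t ∈ Icc 0 T | ¬ DifferentiableAt ℝ (fun s => v s i - v s j) t ∨
      deriv (fun s => v s i - v s j) t = 0}.Finite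

/-! ### The max-projection -/

/-- The step function `1 : ℝ → {0, 1}`. -/
def step (r : ℝ) : ℝ := if 0 ≤ r then 1 else 0

/-- The max-mapping `Q_i(μ) = ∏_{j ≠ i} 1(μ_i - μ_j)`. -/
def maxMap {N : ℕ} (μ : Fin N → ℝ) : Fin N → ℝ :=
  fun i => ∏ j ∈ Finset.univ.erase i, step (μ i - μ j)

/-- The control `Q(u - γ d)`. -/
def updatedControl {N : ℕ} (u d : ℝ → Fin N → ℝ) (γ : ℝ) : ℝ → Fin N → ℝ :=
  fun t => maxMap (u t - γ • d t)

/-- `(z, w) = P(μ)`: `w = Q(μ)`, and `(z, w)` is a feasible trajectory starting at `x0`. -/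
def IsMaxProjection {n N : ℕ} (f : Fin N → State n → State n) (x0 : State n) (T : ℝ)
    (μ : ℝ → Fin N → ℝ) (z : ℝ → State n) (w : ℝ → Fin N → ℝ) : Prop :=
  (w = fun t => maxMap (μ t)) ∧ IsFeasible f x0 T z w

/-! ### Types of the switching times at `γ₀⁺` -/

/-- `(σ, τ(γ))` is the mode schedule of `Q(u - γ d)` for all `γ > γ₀` near `γ₀`. -/
def IsScheduleAfter {N K : ℕ} (T : ℝ) (u d : ℝ → Fin N → ℝ) (γ₀ : ℝ)
    (σ : Fin (K + 1) → Fin N) (τ : ℝ → Fin K → ℝ) : Prop :=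
  ∃ δγ : ℝ, 0 < δγ ∧
    ∀ γ ∈ Ioo γ₀ (γ₀ + δγ), IsSchedule T (updatedControl u d γ) σ (τ γ)

open Classical in
/-- The type at `γ₀⁺` of a switching time `γ ↦ τ γ` between the modes `a` and `b`: it is `0` if the
switching time is constant for `γ > γ₀` near `γ₀`, and otherwise the least `m ≥ 1` for which the
`m`-th derivative of `d_a - d_b` at `τ(γ₀⁺)`, i.e. the limit of its values at `τ(γ)` as `γ ↓ γ₀`,
is nonzero (`⊤` if there is none). -/
def switchingType {N : ℕ} (d : ℝ → Fin N → ℝ) (γ₀ : ℝ) (τ : ℝ → ℝ) (a b : Fin N) : ℕ∞ :=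
  if ∃ δγ : ℝ, 0 < δγ ∧ ∃ c : ℝ, ∀ γ ∈ Ioo γ₀ (γ₀ + δγ), τ γ = c then 0
  else sInf {m : ℕ∞ | ∃ k : ℕ, m = (k : ℕ∞) ∧ 1 ≤ k ∧ ∃ L : ℝ, L ≠ 0 ∧
    Tendsto (fun γ => iteratedDeriv k (fun t => d t a - d t b) (τ γ)) (𝓝[>] γ₀) (𝓝 L)}

/-- The greatest type `m̄` among the switching times of the schedule `(σ, τ(γ))` at `γ₀⁺`
(`0` if there are no switching times). -/
def greatestType {N K : ℕ} (d : ℝ → Fin N → ℝ) (γ₀ : ℝ)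
    (σ : Fin (K + 1) → Fin N) (τ : ℝ → Fin K → ℝ) : ℕ∞ :=
  ⨆ i : Fin K, switchingType d γ₀ (fun γ => τ γ i) (σ i.castSucc) (σ i.succ)

/-- `-d` is a descent direction at `(x, u)`: for some `δγ > 0` and all `γ ∈ (γ₀, γ₀ + δγ)`, the
max-projection `P(u - γ d)` exists and its cost is less than the cost of `(x, u)`. -/
def IsDescentDirection {n N : ℕ} (f : Fin N → State n → State n) (ℓ : State n → ℝ)
    (x0 : State n) (T : ℝ) (x : ℝ → State n) (u d : ℝ → Fin N → ℝ) : Prop :=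
  ∃ δγ : ℝ, 0 < δγ ∧ ∀ γ ∈ Ioo (gammaZero T d) (gammaZero T d + δγ),
    (∃ z w, IsMaxProjection f x0 T (fun t => u t - γ • d t) z w) ∧
    ∀ z w, IsMaxProjection f x0 T (fun t => u t - γ • d t) z w → cost ℓ T z < cost ℓ T x

end SwitchedSystem

end

open SwitchedSystem

namespace SwitchedSystem

/-! ### Integrability along switching controls -/

/-! Write `w = Q(u - γ d)` and let `λ(γ)` be the length of time for which `w ≠ u`. The proof rests
on three facts about `λ`.

The first is a first-order expansion with quadratic error (`IsFeasible.exists_cost_sub_le`): for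
small `λ` a trajectory `z` for `w` exists, and `J(z) - J(x)` is at most `∫ ⟪ρ, F(x, w) - F(x, u)⟫ +
C λ²`. Gronwall gives `z - x = O(λ)`, and pairing `z - x` with the adjoint removes the linear terms.
Where `u = e_a` and `w = e_b` with `b ≠ a`, the integrand is `d_b`. Since `d_a = 0`, mode `b` can
only win the maximum if `-γ d_b > 1`, ties being null. Hence the change of cost is at most `-λ/γ + C
λ²` (`inner_vectorField_updatedControl_sub_le`).

The second is `λ(γ) → 0` as `γ ↓ γ₀` (`tendsto_integral_updatedControl_ne`): `d_b ≥ θ = -1/γ₀`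
everywhere, and level sets of `d_b - d_a` are finite because critical points are
(`finite_level_set`).

The third is `λ(γ) > 0`, which is where the types enter. If `λ(γ) = 0`, then `w = u` almost
everywhere for all smaller step sizes above `γ₀` (`updatedControl_ae_eq_of_lt`), so the schedule of
`u` is a constant schedule for the updates, and the greatest type is `0`. No rate for `λ` is needed:
`-λ/γ + C λ² < 0` as soon as `λ` is positive and small. -/

theorem intervalIntegrable_of_isPiecewiseConstant {V : Type*} [NormedAddCommGroup V] {T : ℝ}
    (hT : 0 < T) {g : ℝ → V} (hg : IsPiecewiseConstant T g) {C : ℝ}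
    (hC : ∀ t ∈ Icc 0 T, ‖g t‖ ≤ C) : IntervalIntegrable g volume 0 T := by
  obtain ⟨S, hS, h⟩ := hg
  rw [intervalIntegrable_iff_integrableOn_Ioo_of_le hT.le]
  have hopen : IsOpen (Ioo 0 T \ S) := isOpen_Ioo.sdiff hS.isClosed
  have hae : (Ioo 0 T \ S : Set ℝ) =ᵐ[volume] Ioo 0 T :=
    sdiff_null_ae_eq_self (hS.measure_zero _)
  rw [← integrableOn_congr_set_ae hae]
  have : IsFiniteMeasure (volume.restrict (Ioo 0 T \ S)) :=
    ⟨by rw [Measure.restrict_apply_univ]; exact (measure_mono sdiff_subset).trans_lt (by simp)⟩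
  refine Integrable.of_bound ?_ C ?_
  · refine ContinuousOn.aestronglyMeasurable (fun t ht => ?_) hopen.measurableSet
    exact (continuousAt_const.congr
      ((h t ht).mono fun s hs => hs.symm)).continuousWithinAt
  · exact (ae_restrict_mem hopen.measurableSet).mono
      fun t ht => hC t (Ioo_subset_Icc_self ht.1)

theorem IsPiecewiseConstant.comp₂ {α β κ : Type*} {T : ℝ} {g : ℝ → α} {h : ℝ → β}
    (hg : IsPiecewiseConstant T g) (hh : IsPiecewiseConstant T h) (φ : α → β → κ) :
    IsPiecewiseConstant T (fun t => φ (g t) (h t)) := by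
  obtain ⟨S, hS, hg⟩ := hg
  obtain ⟨S', hS', hh⟩ := hh
  refine ⟨S ∪ S', hS.union hS', fun t ht => ?_⟩
  filter_upwards [hg t ⟨ht.1, fun h => ht.2 (Or.inl h)⟩, hh t ⟨ht.1, fun h => ht.2 (Or.inr h)⟩]
    with s h1 h2
  rw [h1, h2]

theorem IsSwitchingControl.intervalIntegrable {N : ℕ} {T : ℝ} (hT : 0 < T)
    {u : ℝ → Fin N → ℝ} (hu : IsSwitchingControl T u) (i : Fin N) :
    IntervalIntegrable (fun t => u t i) volume 0 T := by
  refine intervalIntegrable_of_isPiecewiseConstant hT (C := 1)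
    (hu.piecewiseConstant.comp₂ hu.piecewiseConstant fun v _ => v i) fun t ht => ?_
  rcases hu.zero_or_one t ht i with h | h <;> simp [h]

theorem IsSwitchingControl.intervalIntegrable_sum_smul {N : ℕ} {T : ℝ} (hT : 0 < T)
    {u : ℝ → Fin N → ℝ} (hu : IsSwitchingControl T u) {V : Type*} [NormedAddCommGroup V]
    [NormedSpace ℝ V] {φ : Fin N → ℝ → V} (hφ : ∀ i, ContinuousOn (φ i) (Icc 0 T)) :
    IntervalIntegrable (fun t => ∑ i, u t i • φ i t) volume 0 T := by
  have := IntervalIntegrable.sum (μ := volume) (a := 0) (b := T) Finset.univ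
    (f := fun i t => u t i • φ i t)
    fun i _ => (hu.intervalIntegrable hT i).smul_continuousOn (by rw [uIcc_of_le hT.le]; exact hφ i)
  rw [Finset.sum_fn] at this
  exact this

/-- The control has mode `a` around the time `t`. -/
def HasModeAt {N : ℕ} (u : ℝ → Fin N → ℝ) (t : ℝ) (a : Fin N) : Prop :=
  ∀ᶠ s in 𝓝 t, u s = Pi.single a 1

theorem HasModeAt.eq {N : ℕ} {u : ℝ → Fin N → ℝ} {t : ℝ} {a : Fin N} (h : HasModeAt u t a) :
    u t = Pi.single a 1 :=
  h.self_of_nhds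

theorem exists_eq_single {N : ℕ} {v : Fin N → ℝ} (h01 : ∀ i, v i = 0 ∨ v i = 1)
    (hsum : ∑ i, v i = 1) : ∃ a, v = Pi.single a 1 := by
  obtain ⟨a, ha⟩ : ∃ a, v a ≠ 0 := by
    by_contra! h
    simp [h] at hsum
  have ha1 : v a = 1 := (h01 a).resolve_left ha
  refine ⟨a, funext fun i => ?_⟩
  rcases eq_or_ne i a with rfl | hi
  · simpa using ha1
  · rw [Pi.single_eq_of_ne hi]
    rw [← Finset.add_sum_erase _ _ (Finset.mem_univ a), ha1, add_eq_left,
      Finset.sum_eq_zero_iff_of_nonneg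
        (fun j _ => by rcases h01 j with h | h <;> simp [h])] at hsum
    exact hsum i (by simp [hi])

theorem IsSwitchingControl.exists_hasModeAt {N : ℕ} {T : ℝ} {u : ℝ → Fin N → ℝ}
    (hu : IsSwitchingControl T u) :
    ∃ S : Set ℝ, S.Finite ∧ ∀ t ∈ Ioo 0 T \ S, ∃ a, HasModeAt u t a := by
  obtain ⟨S, hS, h⟩ := hu.piecewiseConstant
  refine ⟨S, hS, fun t ht => ?_⟩
  have hev : ∀ᶠ s in 𝓝 t, u s = u t ∧ s ∈ Icc 0 T :=
    (h t ht).and (Icc_mem_nhds ht.1.1 ht.1.2)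
  -- The sum is known only almost everywhere; a set of full measure is dense, so it holds at some
  -- nearby `s` with `u s = u t`.
  obtain ⟨s, hs1, hs, hsT⟩ := (Measure.dense_of_ae hu.sum_eq_one).inter_nhds_nonempty hev
  obtain ⟨a, ha⟩ := exists_eq_single (hu.zero_or_one t (Ioo_subset_Icc_self ht.1))
    (by rw [← hs]; exact hs1 hsT)
  exact ⟨a, (h t ht).mono fun s hs => hs.trans ha⟩

theorem vectorField_single {n N : ℕ} (f : Fin N → State n → State n) (y : State n)
    (a : Fin N) : vectorField f y (Pi.single a 1) = f a y := by
  simp [vectorField, Pi.single_apply, ite_smul]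

theorem sum_single_smul {N : ℕ} {V : Type*} [AddCommGroup V] [Module ℝ V] (φ : Fin N → V)
    (a : Fin N) : ∑ i, (Pi.single a (1 : ℝ) : Fin N → ℝ) i • φ i = φ a := by
  simp [Pi.single_apply, ite_smul]

theorem ae_of_forall_diff_finite {T : ℝ} {S : Set ℝ} (hS : S.Finite) {p : ℝ → Prop}
    (h : ∀ t ∈ Ioo 0 T \ S, p t) : ∀ᵐ t : ℝ, t ∈ Icc 0 T → p t := by
  have h0 : volume (S ∪ {0, T}) = 0 := (hS.union (by simp)).measure_zero _
  filter_upwards [measure_eq_zero_iff_ae_notMem.1 h0] with t ht htT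
  simp only [mem_union, mem_insert_iff, mem_singleton_iff, not_or] at ht
  exact h t ⟨⟨lt_of_le_of_ne htT.1 (Ne.symm ht.2.1), lt_of_le_of_ne htT.2 ht.2.2⟩, ht.1⟩

theorem intervalIntegral_mono_ae {T : ℝ} (hT : 0 < T) {g h : ℝ → ℝ}
    (hg : IntervalIntegrable g volume 0 T) (hh : IntervalIntegrable h volume 0 T)
    {t : ℝ} (ht : t ∈ Icc 0 T) (hgh : ∀ᵐ s : ℝ, s ∈ Icc 0 T → g s ≤ h s) :
    ∫ s in (0 : ℝ)..t, g s ≤ ∫ s in (0 : ℝ)..t, h s := by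
  have hsub : uIcc 0 t ⊆ uIcc 0 T := by
    rw [uIcc_of_le ht.1, uIcc_of_le hT.le]; exact Icc_subset_Icc_right ht.2
  refine intervalIntegral.integral_mono_ae_restrict ht.1 (hg.mono_set hsub) (hh.mono_set hsub) ?_
  rw [EventuallyLE, ae_restrict_iff' measurableSet_Icc]
  exact hgh.mono fun s hs hst => hs ⟨hst.1, hst.2.trans ht.2⟩

/-! ### Gronwall's inequality in integral form -/

/-- The right-hand side `U` satisfies `U' = L φ ≤ L U`, so the differential form of Gronwall applies
to `U`. Extending `φ` continuously to all of `ℝ` makes `U` differentiable at the endpoints too. -/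
theorem le_mul_exp_of_le_add_integral {T A L : ℝ} (hT : 0 < T) (hL : 0 ≤ L) {φ : ℝ → ℝ}
    (hφ : ContinuousOn φ (Icc 0 T))
    (h : ∀ t ∈ Icc 0 T, φ t ≤ A + L * ∫ s in (0 : ℝ)..t, φ s) :
    ∀ t ∈ Icc 0 T, φ t ≤ A * Real.exp (L * t) := by
  set ψ : ℝ → ℝ := IccExtend hT.le ((Icc 0 T).domRestrict φ) with hψ
  have hψc : Continuous ψ := continuous_IccExtend_iff.2 hφ.domRestrict
  have hψφ : ∀ t ∈ Icc 0 T, ψ t = φ t := fun t ht => by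
    rw [hψ, IccExtend_of_mem _ _ ht]; rfl
  set U : ℝ → ℝ := fun t => A + L * ∫ s in (0 : ℝ)..t, ψ s with hU
  have hUd : ∀ t, HasDerivAt U (L * ψ t) t := fun t =>
    ((hψc.integral_hasStrictDerivAt 0 t).hasDerivAt.const_mul L).const_add A
  have hle : ∀ t ∈ Icc 0 T, ψ t ≤ U t := fun t ht => by
    rw [hψφ t ht]
    refine (h t ht).trans_eq ?_
    have : ∫ s in (0 : ℝ)..t, φ s = ∫ s in (0 : ℝ)..t, ψ s :=
      intervalIntegral.integral_congr fun s hs => by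
        rw [uIcc_of_le ht.1] at hs
        exact (hψφ s ⟨hs.1, hs.2.trans ht.2⟩).symm
    simp only [hU, this]
  intro t ht
  have hG := le_gronwallBound_of_liminf_deriv_right_le (f := U) (f' := fun t => L * ψ t)
    (δ := A) (K := L) (ε := 0) (a := 0) (b := T)
    (fun s _ => (hUd s).continuousAt.continuousWithinAt)
    (fun s _ r hr => (hUd s).hasDerivWithinAt.liminf_right_slope_le hr)
    (by simp [hU]) (fun s hs => by
      have := mul_le_mul_of_nonneg_left (hle s (Ico_subset_Icc_self hs)) hL
      simpa using this) t ht
  rw [gronwallBound_ε0, sub_zero] at hG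
  rw [← hψφ t ht]
  exact (hle t ht).trans hG

/-! ### Solutions of the switched system -/

theorem norm_vectorField_sub_le {n N : ℕ} {f : Fin N → State n → State n} {K : NNReal}
    {s : Set (State n)} (hf : ∀ i, LipschitzOnWith K (f i) s) {v : Fin N → ℝ}
    (hv : ∀ i, v i = 0 ∨ v i = 1) {y z : State n} (hy : y ∈ s) (hz : z ∈ s) :
    ‖vectorField f y v - vectorField f z v‖ ≤ N * K * ‖y - z‖ := by
  rw [vectorField, vectorField, ← Finset.sum_sub_distrib]
  refine (norm_sum_le_of_le (n := fun _ => K * ‖y - z‖) _ fun i _ => ?_).trans_eq ?_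
  · rw [← smul_sub, norm_smul]
    have h1 : ‖v i‖ ≤ 1 := by rcases hv i with h | h <;> simp [h]
    have h2 := (hf i).norm_sub_le hy hz
    calc ‖v i‖ * ‖f i y - f i z‖ ≤ 1 * (K * ‖y - z‖) := by gcongr
      _ = _ := one_mul _
  · simp [mul_assoc]

theorem intervalIntegrable_vectorField {n N : ℕ} {T : ℝ} (hT : 0 < T)
    {f : Fin N → State n → State n} (hf : ∀ i, Continuous (f i)) {u : ℝ → Fin N → ℝ}
    (hu : IsSwitchingControl T u) {x : ℝ → State n} (hx : ContinuousOn x (Icc 0 T)) :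
    IntervalIntegrable (fun t => vectorField f (x t) (u t)) volume 0 T :=
  hu.intervalIntegrable_sum_smul hT fun i => (hf i).comp_continuousOn hx

/-- A switched system with globally Lipschitz modes has a solution on `[0, T]`. -/
theorem exists_solution_of_lipschitz {n N : ℕ} {T : ℝ} (hT : 0 < T)
    {f : Fin N → State n → State n} {K : NNReal} (hf : ∀ i, LipschitzWith K (f i))
    {u : ℝ → Fin N → ℝ} (hu : IsSwitchingControl T u) (x0 : State n) :
    ∃ z : ℝ → State n, ContinuousOn z (Icc 0 T) ∧
      ∀ t ∈ Icc 0 T, z t = x0 + ∫ s in (0 : ℝ)..t, vectorField f (z s) (u s) := by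
  set L : ℝ := N * K with hL
  have hL0 : 0 ≤ L := by positivity
  -- Picard iteration in one step: the unknown is `g t = exp (-κ t) • z t`, and in this weighted
  -- norm the contraction constant is `L / κ ≤ 1 / 2`, whatever the length of `[0, T]`.
  set κ : ℝ := 2 * L + 1 with hκ
  have hκ0 : 0 < κ := by positivity
  have h0T : (0 : ℝ) ∈ Icc 0 T := ⟨le_rfl, hT.le⟩
  let ext : C(Icc (0 : ℝ) T, State n) → ℝ → State n :=
    fun g t => Real.exp (κ * t) • IccExtend hT.le g t
  have hext : ∀ g, Continuous (ext g) := fun g =>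
    (by fun_prop : Continuous fun t : ℝ => Real.exp (κ * t)).smul
      (continuous_IccExtend_iff.2 g.continuous)
  have hint : ∀ g, IntervalIntegrable (fun t => vectorField f (ext g t) (u t)) volume 0 T :=
    fun g => intervalIntegrable_vectorField hT (fun i => (hf i).continuous) hu
      (hext g).continuousOn
  have hprim : ∀ g, ContinuousOn
      (fun t => ∫ s in (0 : ℝ)..t, vectorField f (ext g s) (u s)) (Icc 0 T) := fun g => by
    have := intervalIntegral.continuousOn_primitive_interval (μ := volume) (a := 0) (b := T)
      (f := fun t => vectorField f (ext g t) (u t))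
      (by rw [uIcc_of_le hT.le, integrableOn_Icc_iff_integrableOn_Ioc,
            ← intervalIntegrable_iff_integrableOn_Ioc_of_le hT.le]; exact hint g)
    rwa [uIcc_of_le hT.le] at this
  let Φ : C(Icc (0 : ℝ) T, State n) → C(Icc (0 : ℝ) T, State n) := fun g =>
    ⟨(Icc 0 T).domRestrict fun t => Real.exp (-(κ * t)) •
        (x0 + ∫ s in (0 : ℝ)..t, vectorField f (ext g s) (u s)),
      ContinuousOn.domRestrict ((by fun_prop : Continuous fun t : ℝ =>
        Real.exp (-(κ * t))).continuousOn.smul (continuousOn_const.add (hprim g)))⟩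
  have hΦ : ∀ g (t : Icc (0 : ℝ) T), Φ g t = Real.exp (-(κ * t)) •
        (x0 + ∫ s in (0 : ℝ)..t, vectorField f (ext g s) (u s)) := fun g t => rfl
  have hcontr : ContractingWith (1 / 2) Φ := by
    refine ⟨by norm_num, LipschitzWith.of_dist_le_mul fun g h => ?_⟩
    rw [ContinuousMap.dist_le (by positivity)]
    rintro ⟨t, ht⟩
    have hsub : uIcc 0 t ⊆ uIcc 0 T := by
      rw [uIcc_of_le ht.1, uIcc_of_le hT.le]; exact Icc_subset_Icc_right ht.2
    rw [hΦ, hΦ, dist_eq_norm, ← smul_sub, add_sub_add_left_eq_sub, norm_smul,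
      ← intervalIntegral.integral_sub ((hint g).mono_set hsub) ((hint h).mono_set hsub)]
    have hb : ‖∫ s in (0 : ℝ)..t, (vectorField f (ext g s) (u s) - vectorField f (ext h s) (u s))‖
        ≤ ∫ s in (0 : ℝ)..t, L * dist g h * Real.exp (κ * s) := by
      refine intervalIntegral.norm_integral_le_of_norm_le ht.1 (ae_of_all _ fun s hs => ?_)
        (Continuous.intervalIntegrable (by fun_prop) _ _)
      have hs' : s ∈ Icc 0 T := ⟨hs.1.le, hs.2.trans ht.2⟩
      refine (norm_vectorField_sub_le (fun i => (hf i).lipschitzOnWith (s := univ))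
        (hu.zero_or_one s hs') (mem_univ _) (mem_univ _)).trans ?_
      rw [← hL, mul_assoc L]
      refine mul_le_mul_of_nonneg_left ?_ hL0
      simp only [ext]
      rw [← smul_sub, norm_smul, Real.norm_of_nonneg (Real.exp_pos _).le, mul_comm,
        IccExtend_of_mem _ _ hs', IccExtend_of_mem _ _ hs', ← dist_eq_norm]
      gcongr
      exact ContinuousMap.dist_apply_le_dist _
    have hI : ∫ s in (0 : ℝ)..t, L * dist g h * Real.exp (κ * s)
        = L * dist g h * ((Real.exp (κ * t) - 1) / κ) := by
      rw [intervalIntegral.integral_const_mul,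
        intervalIntegral.integral_comp_mul_left (fun s => Real.exp s) hκ0.ne', integral_exp,
        mul_zero, Real.exp_zero, smul_eq_mul, inv_mul_eq_div]
    rw [hI] at hb
    rw [Real.norm_of_nonneg (Real.exp_pos _).le]
    calc Real.exp (-(κ * t)) * _ ≤ Real.exp (-(κ * t)) *
          (L * dist g h * ((Real.exp (κ * t) - 1) / κ)) := by gcongr
      _ = (L / κ) * dist g h * (1 - Real.exp (-(κ * t))) := by
          rw [Real.exp_neg]; field_simp
      _ ≤ (1 / 2) * dist g h * 1 := by
          have h1 : L / κ ≤ 1 / 2 := by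
            rw [div_le_div_iff₀ hκ0 two_pos]; rw [hκ]; linarith
          have h2 : 0 ≤ 1 - Real.exp (-(κ * t)) := by
            have := mul_nonneg hκ0.le ht.1
            simpa using this
          have h3 : 1 - Real.exp (-(κ * t)) ≤ 1 := by
            linarith [Real.exp_pos (-(κ * t))]
          gcongr
      _ = _ := by simp
  obtain ⟨g, hg⟩ : ∃ g, Φ g = g := ⟨hcontr.fixedPoint, hcontr.fixedPoint_isFixedPt⟩
  refine ⟨ext g, (hext g).continuousOn, fun t ht => ?_⟩
  have h1 : ext g t = Real.exp (κ * t) • g ⟨t, ht⟩ := by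
    simp only [ext, IccExtend_of_mem _ _ ht]
  rw [h1]
  conv_lhs => rw [← hg, hΦ]
  rw [smul_smul, ← Real.exp_add]
  simp

/-- Two solutions of the switched system, for two controls, differ by at most a constant times the
length of time for which the controls differ. -/
theorem norm_solution_sub_le {n N : ℕ} {T : ℝ} (hT : 0 < T) {f : Fin N → State n → State n}
    (hfc : ∀ i, Continuous (f i)) {K : NNReal} {s : Set (State n)}
    (hf : ∀ i, LipschitzOnWith K (f i) s) {u w : ℝ → Fin N → ℝ}
    (hu : IsSwitchingControl T u) (hw : IsSwitchingControl T w) {x0 : State n}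
    {x z : ℝ → State n} (hx : ContinuousOn x (Icc 0 T)) (hz : ContinuousOn z (Icc 0 T))
    (hxe : ∀ t ∈ Icc 0 T, x t = x0 + ∫ r in (0 : ℝ)..t, vectorField f (x r) (u r))
    (hze : ∀ t ∈ Icc 0 T, z t = x0 + ∫ r in (0 : ℝ)..t, vectorField f (z r) (w r))
    (hxs : ∀ t ∈ Icc 0 T, x t ∈ s) (hzs : ∀ t ∈ Icc 0 T, z t ∈ s) {M : ℝ} (hM0 : 0 ≤ M)
    (hM : ∀ i, ∀ t ∈ Icc 0 T, ‖f i (x t)‖ ≤ M) :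
    ∀ t ∈ Icc 0 T, ‖z t - x t‖ ≤
      N * M * (∫ r in (0 : ℝ)..T, if w r = u r then 0 else 1) * Real.exp (N * K * T) := by
  set δ : ℝ → ℝ := fun r => if w r = u r then 0 else 1 with hδ
  have hδi : IntervalIntegrable δ volume 0 T :=
    intervalIntegrable_of_isPiecewiseConstant hT (C := 1)
      (hw.piecewiseConstant.comp₂ hu.piecewiseConstant fun a b => if a = b then (0 : ℝ) else 1)
      fun t _ => by simp only [hδ]; split_ifs <;> simp
  have hδ0 : ∀ r, 0 ≤ δ r := fun r => by simp only [hδ]; split_ifs <;> simp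
  have hφ : ContinuousOn (fun t => ‖z t - x t‖) (Icc 0 T) := (hz.sub hx).norm
  have hφi : IntervalIntegrable (fun t => ‖z t - x t‖) volume 0 T :=
    ContinuousOn.intervalIntegrable (by rwa [uIcc_of_le hT.le])
  have hG := le_mul_exp_of_le_add_integral (A := N * M * ∫ r in (0 : ℝ)..T, δ r) (L := N * K) hT
    (by positivity) hφ fun t ht => ?_
  · intro t ht
    refine (hG t ht).trans ?_
    have h0 : 0 ≤ ∫ r in (0 : ℝ)..T, δ r := intervalIntegral.integral_nonneg hT.le fun r _ => hδ0 r
    have := ht.2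
    gcongr
  · have hsub : uIcc 0 t ⊆ uIcc 0 T := by
      rw [uIcc_of_le ht.1, uIcc_of_le hT.le]; exact Icc_subset_Icc_right ht.2
    have hi1 := (intervalIntegrable_vectorField hT hfc hw hz).mono_set hsub
    have hi2 := (intervalIntegrable_vectorField hT hfc hu hx).mono_set hsub
    have e1 : z t - x t = ∫ r in (0 : ℝ)..t,
        (vectorField f (z r) (w r) - vectorField f (x r) (u r)) := by
      rw [intervalIntegral.integral_sub hi1 hi2, hze t ht, hxe t ht]; abel
    have hδt := hδi.mono_set hsub
    have hφt := hφi.mono_set hsub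
    rw [e1]
    refine (intervalIntegral.norm_integral_le_of_norm_le ht.1
      (g := fun r => N * M * δ r + N * K * ‖z r - x r‖) (ae_of_all _ fun r hr => ?_)
      ((hδt.const_mul _).add (hφt.const_mul _))).trans ?_
    · have hr' : r ∈ Icc 0 T := ⟨hr.1.le, hr.2.trans ht.2⟩
      have h1 := norm_vectorField_sub_le hf (hw.zero_or_one r hr') (hzs r hr') (hxs r hr')
      have h2 : ‖vectorField f (x r) (w r) - vectorField f (x r) (u r)‖ ≤ N * M * δ r := by
        by_cases hwu : w r = u r
        · simp [hδ, hwu]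
        · simp only [hδ, if_neg hwu, mul_one]
          rw [vectorField, vectorField, ← Finset.sum_sub_distrib]
          refine (norm_sum_le_of_le (n := fun _ => M) _ fun i _ => ?_).trans_eq (by simp)
          rw [← sub_smul, norm_smul]
          have h3 : ‖w r i - u r i‖ ≤ 1 := by
            rcases hw.zero_or_one r hr' i with h | h <;>
              rcases hu.zero_or_one r hr' i with h' | h' <;> simp [h, h']
          calc _ ≤ 1 * M := mul_le_mul h3 (hM i r hr') (norm_nonneg _) zero_le_one
            _ = M := one_mul _
      -- Passing through `F(x, w)` separates the change of control, which costs `N * M` where the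
      -- controls differ, from the change of state, which feeds Gronwall.
      calc ‖vectorField f (z r) (w r) - vectorField f (x r) (u r)‖
          = ‖(vectorField f (x r) (w r) - vectorField f (x r) (u r)) +
              (vectorField f (z r) (w r) - vectorField f (x r) (w r))‖ := by congr 1; abel
        _ ≤ _ := (norm_add_le _ _).trans (add_le_add h2 h1)
    · rw [intervalIntegral.integral_add (hδt.const_mul _) (hφt.const_mul _),
        intervalIntegral.integral_const_mul, intervalIntegral.integral_const_mul]
      have : ∫ r in (0 : ℝ)..t, δ r ≤ ∫ r in (0 : ℝ)..T, δ r :=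
        intervalIntegral.integral_mono_interval le_rfl ht.1 ht.2 (ae_of_all _ hδ0) hδi
      gcongr

/-! ### Perturbation of the control -/

theorem exists_uniform_bound {ι : Type*} [Finite ι] {α : Type*} {s : Set α} {g : ι → α → ℝ}
    (h : ∀ i, ∃ C, ∀ t ∈ s, g i t ≤ C) : ∃ C, 0 ≤ C ∧ ∀ i, ∀ t ∈ s, g i t ≤ C := by
  choose C hC using h
  obtain ⟨B, hB⟩ := (finite_range C).bddAbove
  exact ⟨max B 0, le_max_right _ _, fun i t ht =>
    (hC i t ht).trans ((hB (mem_range_self i)).trans (le_max_left _ _))⟩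

/-- A bounded second derivative makes `fderiv ℝ g` Lipschitz, so on the ball around `y` of radius
`‖z - y‖` it stays within `K * ‖z - y‖` of its value at `y`; the mean value inequality does the
rest. -/
theorem IsC2Bounded.exists_taylor_bound {E V : Type*} [NormedAddCommGroup E] [NormedSpace ℝ E]
    [NormedAddCommGroup V] [NormedSpace ℝ V] {g : E → V} (hg : IsC2Bounded g) :
    ∃ K : ℝ, ∀ p : E × E, ‖g p.2 - g p.1 - fderiv ℝ g p.1 (p.2 - p.1)‖ ≤ K * ‖p.2 - p.1‖ ^ 2 := by
  obtain ⟨hg, K, hK0, hK⟩ := hg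
  refine ⟨K, fun ⟨y, z⟩ => ?_⟩
  have hg' : Differentiable ℝ (fderiv ℝ g) :=
    (hg.fderiv_right (m := 1) (by norm_num)).differentiable one_ne_zero
  have hlip : ∀ p, ‖fderiv ℝ g p - fderiv ℝ g y‖ ≤ K * ‖p - y‖ := fun p =>
    convex_univ.norm_image_sub_le_of_norm_fderiv_le (fun q _ => hg' q) (fun q _ => hK q)
      (mem_univ y) (mem_univ p)
  have := (convex_closedBall y ‖z - y‖).norm_image_sub_le_of_norm_hasFDerivWithin_le'
    (f := g) (f' := fderiv ℝ g) (φ := fderiv ℝ g y) (C := K * ‖z - y‖) (x := y) (y := z)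
    (fun p _ => (hg.differentiable two_ne_zero p).hasFDerivAt.hasFDerivWithinAt)
    (fun p hp => (hlip p).trans (by
      have := mem_closedBall_iff_norm.1 hp
      gcongr))
    (by simp) (mem_closedBall_iff_norm.2 le_rfl)
  calc _ ≤ K * ‖z - y‖ * ‖z - y‖ := this
    _ = _ := by ring

theorem hasDerivAt_solution {n N : ℕ} {T : ℝ} (hT : 0 < T) {f : Fin N → State n → State n}
    (hf : ∀ i, Continuous (f i)) {x0 : State n} {z : ℝ → State n} {w : ℝ → Fin N → ℝ}
    (hz : IsFeasible f x0 T z w) {t : ℝ} (ht : t ∈ Ioo 0 T) {b : Fin N} (hb : HasModeAt w t b) :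
    HasDerivAt z (f b (z t)) t := by
  have hi := intervalIntegrable_vectorField hT hf hz.control.1 hz.continuousOn
  have hsub : uIcc 0 t ⊆ uIcc 0 T := by
    rw [uIcc_of_le ht.1.le, uIcc_of_le hT.le]; exact Icc_subset_Icc_right ht.2.le
  have hzt : ContinuousAt z t := hz.continuousOn.continuousAt (Icc_mem_nhds ht.1 ht.2)
  have hev : (fun s => f b (z s)) =ᶠ[𝓝 t] fun s => vectorField f (z s) (w s) :=
    hb.mono fun s hs => by
      show _ = vectorField f (z s) (w s)
      rw [hs, vectorField_single]
  have hder := intervalIntegral.integral_hasDerivAt_right (hi.mono_set hsub)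
    ⟨Ioc 0 T, Ioc_mem_nhds ht.1 ht.2, hi.aestronglyMeasurable⟩
    (((hf b).continuousAt.comp hzt).congr hev)
  rw [hb.eq, vectorField_single] at hder
  refine (hder.const_add x0).congr_of_eventuallyEq ?_
  filter_upwards [Icc_mem_nhds ht.1 ht.2] with s hs using hz.state_eq s hs

/-- This is the estimate of `norm_solution_sub_le` for two equal controls, on a ball that contains
both trajectories. It turns bounds for one constructed solution into bounds for every solution. -/
theorem IsFeasible.eqOn {n N : ℕ} {T : ℝ} (hT : 0 < T) {f : Fin N → State n → State n}
    (hf : ∀ i, ContDiff ℝ 1 (f i)) {x0 : State n} {y z : ℝ → State n} {w : ℝ → Fin N → ℝ}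
    (hy : IsFeasible f x0 T y w) (hz : IsFeasible f x0 T z w) : EqOn z y (Icc 0 T) := by
  obtain ⟨r₁, hr₁⟩ := isCompact_Icc.exists_bound_of_continuousOn hy.continuousOn
  obtain ⟨r₂, hr₂⟩ := isCompact_Icc.exists_bound_of_continuousOn hz.continuousOn
  set B : Set (State n) := Metric.closedBall 0 (max r₁ r₂)
  choose K hK using fun i => (hf i).contDiffOn.exists_lipschitzOnWith one_ne_zero
    (convex_closedBall (0 : State n) (max r₁ r₂)) (isCompact_closedBall _ _)
  obtain ⟨M, hM0, hM⟩ := exists_uniform_bound (s := Icc 0 T) (g := fun i t => ‖f i (y t)‖) fun i =>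
    isCompact_Icc.exists_bound_of_continuousOn ((hf i).continuous.comp_continuousOn hy.continuousOn)
  intro t ht
  have := norm_solution_sub_le hT (fun i => (hf i).continuous) (K := ∑ i, K i) (s := B)
    (fun i => (hK i).weaken (Finset.single_le_sum (f := K) (fun _ _ => zero_le) (Finset.mem_univ i)))
    hy.control.1 hz.control.1 hy.continuousOn hz.continuousOn hy.state_eq hz.state_eq
    (fun t ht => by simpa [B] using Or.inl (hr₁ t ht))
    (fun t ht => by simpa [B] using Or.inr (hr₂ t ht)) hM0 hM t ht
  simp only [if_true, intervalIntegral.integral_zero, mul_zero, zero_mul] at this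
  exact sub_eq_zero.1 (norm_le_zero_iff.1 this)

/-- A control that differs from that of a feasible trajectory for a short time only also has a
feasible trajectory, which stays close to the given one. -/
theorem IsFeasible.exists_near {n N : ℕ} {T : ℝ} (hT : 0 < T) {f : Fin N → State n → State n}
    (hf : ∀ i, ContDiff ℝ 1 (f i)) {x0 : State n} {x : ℝ → State n} {u : ℝ → Fin N → ℝ}
    (hxu : IsFeasible f x0 T x u) :
    ∃ ε C : ℝ, 0 < ε ∧ 0 ≤ C ∧ ∀ w, IsNonChatteringControl T w →
      (∫ t in (0 : ℝ)..T, if w t = u t then (0 : ℝ) else 1) ≤ ε →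
      ∃ z, IsFeasible f x0 T z w ∧ ∀ t ∈ Icc 0 T, ‖z t - x t‖ ≤
        C * ∫ t in (0 : ℝ)..T, if w t = u t then (0 : ℝ) else 1 := by
  obtain ⟨r, hr⟩ := isCompact_Icc.exists_bound_of_continuousOn hxu.continuousOn
  set B : Set (State n) := Metric.closedBall 0 (r + 1) with hB
  choose K hK using fun i => (hf i).contDiffOn.exists_lipschitzOnWith one_ne_zero
    (convex_closedBall (0 : State n) (r + 1)) (isCompact_closedBall _ _)
  -- The modes are Lipschitz only on bounded sets, so they are replaced by global Lipschitz
  -- extensions from the ball `B`. A solution for the extensions that never leaves `B` solves the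
  -- original system.
  choose g hg hgf using fun i => (hK i).extend_finite_dimension
  obtain ⟨M, hM0, hM⟩ := exists_uniform_bound (s := Icc 0 T) (g := fun i t => ‖f i (x t)‖) fun i =>
    isCompact_Icc.exists_bound_of_continuousOn ((hf i).continuous.comp_continuousOn hxu.continuousOn)
  set K' : NNReal := ∑ i, lipschitzExtensionConstant (State n) * K i with hK'
  have hgK : ∀ i, LipschitzWith K' (g i) := fun i => (hg i).weaken
    (Finset.single_le_sum (f := fun i => lipschitzExtensionConstant (State n) * K i)
      (fun _ _ => zero_le) (Finset.mem_univ i))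
  have hvf : ∀ y ∈ B, ∀ v, vectorField g y v = vectorField f y v := fun y hy v =>
    Finset.sum_congr rfl fun i _ => by rw [hgf i hy]
  have hxB : ∀ t ∈ Icc 0 T, x t ∈ B := fun t ht => by
    have := hr t ht
    simp only [hB, mem_closedBall_zero_iff]; linarith
  have hxg : ∀ t ∈ Icc 0 T, x t = x0 + ∫ s in (0 : ℝ)..t, vectorField g (x s) (u s) :=
    fun t ht => by
      rw [hxu.state_eq t ht]
      congr 1
      refine intervalIntegral.integral_congr fun s hs => ?_
      rw [uIcc_of_le ht.1] at hs
      exact (hvf _ (hxB s ⟨hs.1, hs.2.trans ht.2⟩) _).symm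
  set C : ℝ := N * M * Real.exp (N * K' * T) with hC
  have hC0 : 0 ≤ C := by positivity
  -- With this bound `C * lam ≤ 1`, the margin by which the radius of `B` exceeds the bound `r` for
  -- `x`.
  refine ⟨1 / (C + 1), C, by positivity, hC0, fun w hw hε => ?_⟩
  set lam := ∫ t in (0 : ℝ)..T, if w t = u t then (0 : ℝ) else 1
  obtain ⟨z, hzc, hze⟩ := exists_solution_of_lipschitz hT hgK hw.1 x0
  have hclose : ∀ t ∈ Icc 0 T, ‖z t - x t‖ ≤ C * lam := fun t ht => by
    have := norm_solution_sub_le hT (fun i => (hgK i).continuous) (s := univ)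
      (fun i => (hgK i).lipschitzOnWith) hxu.control.1 hw.1 hxu.continuousOn hzc hxg hze
      (fun _ _ => mem_univ _) (fun _ _ => mem_univ _) hM0
      (fun i t ht => by rw [← hgf i (hxB t ht)]; exact hM i t ht) t ht
    refine this.trans_eq ?_
    rw [hC]; ring
  have hzB : ∀ t ∈ Icc 0 T, z t ∈ B := fun t ht => by
    have h1 := hclose t ht
    have h2 : C * lam ≤ 1 := by
      calc C * lam ≤ C * (1 / (C + 1)) := by gcongr
        _ ≤ 1 := by rw [mul_one_div, div_le_one (by positivity)]; linarith
    have h3 := hr t ht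
    have h4 : ‖z t‖ ≤ ‖z t - x t‖ + ‖x t‖ := by simpa using norm_add_le (z t - x t) (x t)
    simp only [hB, mem_closedBall_zero_iff]; linarith
  refine ⟨z, ⟨hw, hzc, fun t ht => ?_⟩, hclose⟩
  rw [hze t ht]
  congr 1
  refine intervalIntegral.integral_congr fun s hs => ?_
  rw [uIcc_of_le ht.1] at hs
  exact hvf _ (hzB s ⟨hs.1, hs.2.trans ht.2⟩) _

/-- Expansion of the cost under a change of the control: up to an error that is quadratic in the
length of time for which the controls differ, the change of the cost is the integral of
`⟪ρ, F(x, w) - F(x, u)⟫`. -/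
theorem IsFeasible.exists_cost_sub_le {n N : ℕ} {T : ℝ} (hT : 0 < T)
    {f : Fin N → State n → State n} {ℓ : State n → ℝ} (hf : ∀ i, IsC2Bounded (f i))
    (hℓ : IsC2Bounded ℓ) {x0 : State n} {x : ℝ → State n} {u : ℝ → Fin N → ℝ}
    (hxu : IsFeasible f x0 T x u) {ρ : ℝ → State n} (hρ : IsAdjoint f ℓ T x u ρ) :
    ∃ ε C : ℝ, 0 < ε ∧ 0 ≤ C ∧ ∀ w, IsNonChatteringControl T w →
      (∫ t in (0 : ℝ)..T, if w t = u t then (0 : ℝ) else 1) ≤ ε →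
      (∃ z, IsFeasible f x0 T z w) ∧ ∀ z, IsFeasible f x0 T z w → ∀ c : ℝ,
        (∀ᵐ t : ℝ, t ∈ Icc 0 T → inner ℝ (ρ t) (vectorField f (x t) (w t) -
          vectorField f (x t) (u t)) ≤ -c * if w t = u t then (0 : ℝ) else 1) →
        cost ℓ T z - cost ℓ T x ≤
          -c * (∫ t in (0 : ℝ)..T, if w t = u t then (0 : ℝ) else 1) +
          C * (∫ t in (0 : ℝ)..T, if w t = u t then (0 : ℝ) else 1) ^ 2 := by
  have hf1 : ∀ i, ContDiff ℝ 1 (f i) := fun i => (hf i).1.of_le one_le_two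
  have hfc : ∀ i, Continuous (f i) := fun i => (hf1 i).continuous
  have hDfc : ∀ i, Continuous (fderiv ℝ (f i)) := fun i => (hf1 i).continuous_fderiv one_ne_zero
  have hℓ1 : ContDiff ℝ 1 ℓ := hℓ.1.of_le one_le_two
  obtain ⟨ε, C₁, hε, hC₁, hnear⟩ := hxu.exists_near hT hf1
  -- Dividing by the square lets one constant serve all modes. At coinciding points the quotient is
  -- `0 / 0 = 0`, so that case is treated apart below.
  obtain ⟨K, hK0, hK⟩ := exists_uniform_bound (s := univ)
    (g := fun i (p : State n × State n) =>
      ‖f i p.2 - f i p.1 - fderiv ℝ (f i) p.1 (p.2 - p.1)‖ / ‖p.2 - p.1‖ ^ 2) fun i => by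
    obtain ⟨K, hK⟩ := (hf i).exists_taylor_bound
    exact ⟨max K 0, fun p _ => div_le_of_le_mul₀ (by positivity) (le_max_right _ _)
      ((hK p).trans (by gcongr; exact le_max_left _ _))⟩
  have hK : ∀ i y z, ‖f i z - f i y - fderiv ℝ (f i) y (z - y)‖ ≤ K * ‖z - y‖ ^ 2 := by
    intro i y z
    rcases eq_or_ne z y with rfl | hzy
    · simp
    · have := hK i (y, z) (mem_univ _)
      have h0 : 0 < ‖z - y‖ ^ 2 := by have := sub_ne_zero.2 hzy; positivity
      rwa [div_le_iff₀ h0] at this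
  obtain ⟨Kℓ', hKℓ'⟩ := hℓ.exists_taylor_bound
  obtain ⟨Kℓ, hKℓ0, hKℓ⟩ : ∃ K, 0 ≤ K ∧ ∀ y z, ‖ℓ z - ℓ y - fderiv ℝ ℓ y (z - y)‖ ≤
      K * ‖z - y‖ ^ 2 :=
    ⟨max Kℓ' 0, le_max_right _ _, fun y z => (hKℓ' (y, z)).trans (by
      gcongr; exact le_max_left _ _)⟩
  obtain ⟨L, hL0, hL⟩ := exists_uniform_bound (s := Icc 0 T)
    (g := fun i t => ‖fderiv ℝ (f i) (x t)‖) fun i =>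
    isCompact_Icc.exists_bound_of_continuousOn ((hDfc i).comp_continuousOn hxu.continuousOn)
  obtain ⟨R', hR'⟩ := isCompact_Icc.exists_bound_of_continuousOn hρ.continuousOn
  obtain ⟨R, hR0, hR⟩ : ∃ R, 0 ≤ R ∧ ∀ t ∈ Icc 0 T, ‖ρ t‖ ≤ R :=
    ⟨max R' 0, le_max_right _ _, fun t ht => (hR' t ht).trans (le_max_left _ _)⟩
  -- The first summand collects the Taylor remainders over `[0, T]`; the second comes from the
  -- mismatch of `Df_b` and `Df_a` where the controls differ.
  refine ⟨ε, (Kℓ + R * K) * C₁ ^ 2 * T + 2 * R * L * C₁, hε, by positivity, fun w hw hle => ?_⟩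
  obtain ⟨z₀, hz₀, hz₀x⟩ := hnear w hw hle
  refine ⟨⟨z₀, hz₀⟩, fun z hz c hc => ?_⟩
  set δ : ℝ → ℝ := fun t => if w t = u t then (0 : ℝ) else 1 with hδ
  set lam : ℝ := ∫ t in (0 : ℝ)..T, δ t with hlam
  have hzx : ∀ t ∈ Icc 0 T, ‖z t - x t‖ ≤ C₁ * lam := fun t ht => by
    rw [hz₀.eqOn hT hf1 hz ht]; exact hz₀x t ht
  have hδ0 : ∀ r, 0 ≤ δ r := fun r => by simp only [hδ]; split_ifs <;> simp
  have hlam0 : 0 ≤ lam := intervalIntegral.integral_nonneg hT.le fun r _ => hδ0 r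
  have hδi : IntervalIntegrable δ volume 0 T :=
    intervalIntegrable_of_isPiecewiseConstant hT (C := 1)
      (hw.1.piecewiseConstant.comp₂ hxu.control.1.piecewiseConstant
        fun a b => if a = b then (0 : ℝ) else 1)
      fun t _ => by simp only [hδ]; split_ifs <;> simp
  obtain ⟨S, hS, hSu⟩ := hxu.control.1.exists_hasModeAt
  obtain ⟨S', hS', hSw⟩ := hw.1.exists_hasModeAt
  -- the derivative of `⟪ρ, z - x⟫`
  set D : ℝ → ℝ := fun t =>
    (∑ i, u t i • (-(inner ℝ (ρ t) (fderiv ℝ (f i) (x t) (z t - x t)) +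
      inner ℝ (ρ t) (f i (x t))))) + (∑ i, w t i • inner ℝ (ρ t) (f i (z t))) -
      fderiv ℝ ℓ (x t) (z t - x t) with hD
  have hxc := hxu.continuousOn
  have hzc := hz.continuousOn
  have hρc := hρ.continuousOn
  have hDi : IntervalIntegrable D volume 0 T := by
    refine ((hxu.control.1.intervalIntegrable_sum_smul hT fun i => ?_).add
      (hw.1.intervalIntegrable_sum_smul hT fun i => ?_)).sub
      (ContinuousOn.intervalIntegrable ?_)
    · exact ((hρc.inner (((hDfc i).comp_continuousOn hxc).clm_apply (hzc.sub hxc))).add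
        (hρc.inner ((hfc i).comp_continuousOn hxc))).neg
    · exact hρc.inner ((hfc i).comp_continuousOn hzc)
    · rw [uIcc_of_le hT.le]
      exact ((hℓ1.continuous_fderiv one_ne_zero).comp_continuousOn hxc).clm_apply (hzc.sub hxc)
  have hDeq : ∀ t a b, u t = Pi.single a 1 → w t = Pi.single b 1 →
      D t = -(inner ℝ (ρ t) (fderiv ℝ (f a) (x t) (z t - x t)) + inner ℝ (ρ t) (f a (x t))) +
        inner ℝ (ρ t) (f b (z t)) - fderiv ℝ ℓ (x t) (z t - x t) := fun t a b ha hb => by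
    simp only [hD, ha, hb]
    rw [sum_single_smul (fun i => -(inner ℝ (ρ t) (fderiv ℝ (f i) (x t) (z t - x t)) +
      inner ℝ (ρ t) (f i (x t)))) a, sum_single_smul (fun i => inner ℝ (ρ t) (f i (z t))) b]
  -- The pairing vanishes at both ends, as `z 0 = x 0` and `ρ T = 0`. Adding `D` to `ℓ(z) - ℓ(x)`
  -- therefore leaves the integral unchanged while cancelling its linear part.
  have hDint : ∫ t in (0 : ℝ)..T, D t = 0 := by
    rw [integral_eq_of_hasDerivAt_off_countable_of_le
      (fun t => inner ℝ (ρ t) (z t - x t)) D hT.le (hS.union hS').countable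
      (hρc.inner (hzc.sub hxc)) (fun t ht => ?_) hDi]
    · have h0 : z 0 - x 0 = 0 := by
        rw [hz.state_eq 0 ⟨le_rfl, hT.le⟩, hxu.state_eq 0 ⟨le_rfl, hT.le⟩]; simp
      simp [h0, hρ.final]
    · obtain ⟨a, ha⟩ := hSu t ⟨ht.1, fun h => ht.2 (Or.inl h)⟩
      obtain ⟨b, hb⟩ := hSw t ⟨ht.1, fun h => ht.2 (Or.inr h)⟩
      have h1 := hρ.adjoint_eq t ht.1 a ha
      have h2 := (hasDerivAt_solution hT hfc hz ht.1 hb).sub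
        (hasDerivAt_solution hT hfc hxu ht.1 ha)
      refine (h1.inner ℝ h2).congr_deriv ?_
      rw [hDeq t a b ha.eq hb.eq, inner_sub_left, inner_neg_left, inner_gradient_left,
        ContinuousLinearMap.adjoint_inner_left, inner_sub_right]
      simp only [Pi.sub_apply]
      ring
  have hbound : ∀ᵐ t : ℝ, t ∈ Icc 0 T → (ℓ (z t) - ℓ (x t)) + D t ≤
      (-c + 2 * R * L * (C₁ * lam)) * δ t + (Kℓ + R * K) * (C₁ * lam) ^ 2 := by
    have hgood := ae_of_forall_diff_finite (T := T) (hS.union hS')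
      (p := fun t => ∃ a b, u t = Pi.single a 1 ∧ w t = Pi.single b 1) fun t ht => by
        obtain ⟨a, ha⟩ := hSu t ⟨ht.1, fun h => ht.2 (Or.inl h)⟩
        obtain ⟨b, hb⟩ := hSw t ⟨ht.1, fun h => ht.2 (Or.inr h)⟩
        exact ⟨a, b, ha.eq, hb.eq⟩
    filter_upwards [hc, hgood] with t hct hgt ht
    obtain ⟨a, b, ha, hb⟩ := hgt ht
    have hct := hct ht
    have hm := hzx t ht
    have hm2 : ‖z t - x t‖ ^ 2 ≤ (C₁ * lam) ^ 2 := by gcongr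
    rw [ha, hb, vectorField_single, vectorField_single, ← ha, ← hb] at hct
    rw [hDeq t a b ha hb]
    have e1 : ℓ (z t) - ℓ (x t) - fderiv ℝ ℓ (x t) (z t - x t) ≤ Kℓ * (C₁ * lam) ^ 2 :=
      (le_abs_self _).trans ((hKℓ (x t) (z t)).trans (by gcongr))
    have e2 : inner ℝ (ρ t) (f b (z t) - f b (x t) - fderiv ℝ (f b) (x t) (z t - x t)) ≤
        R * (K * (C₁ * lam) ^ 2) :=
      (real_inner_le_norm _ _).trans (mul_le_mul (hR t ht)
        ((hK b (x t) (z t)).trans (by gcongr)) (norm_nonneg _) hR0)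
    -- This term is only linear in `z - x`, but it lives where the controls differ, so its integral
    -- is again of order `lam ^ 2`.
    have e3 : inner ℝ (ρ t) (fderiv ℝ (f b) (x t) (z t - x t) -
        fderiv ℝ (f a) (x t) (z t - x t)) ≤ 2 * R * L * (C₁ * lam) * δ t := by
      by_cases hwu : w t = u t
      · have hab : a = b := by
          by_contra hne
          have := congrFun (hb.symm.trans (hwu.trans ha)) a
          simp [hne] at this
        simp [hδ, hwu, hab]
      · simp only [hδ, if_neg hwu, mul_one]
        have h4 : ∀ i, ‖fderiv ℝ (f i) (x t) (z t - x t)‖ ≤ L * (C₁ * lam) := fun i =>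
          (ContinuousLinearMap.le_opNorm _ _).trans
            (mul_le_mul (hL i t ht) hm (norm_nonneg _) hL0)
        calc _ ≤ R * (L * (C₁ * lam) + L * (C₁ * lam)) :=
              (real_inner_le_norm _ _).trans (mul_le_mul (hR t ht)
                ((norm_sub_le _ _).trans (add_le_add (h4 b) (h4 a))) (norm_nonneg _) hR0)
          _ = _ := by ring
    simp only [inner_sub_right] at e2 e3 hct
    have hδt : δ t = if w t = u t then (0 : ℝ) else 1 := rfl
    rw [← hδt] at hct
    linarith
  have hcz : IntervalIntegrable (fun t => ℓ (z t)) volume 0 T :=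
    ContinuousOn.intervalIntegrable (by
      rw [uIcc_of_le hT.le]; exact hℓ1.continuous.comp_continuousOn hzc)
  have hcx : IntervalIntegrable (fun t => ℓ (x t)) volume 0 T :=
    ContinuousOn.intervalIntegrable (by
      rw [uIcc_of_le hT.le]; exact hℓ1.continuous.comp_continuousOn hxc)
  have hmain := intervalIntegral_mono_ae hT ((hcz.sub hcx).add hDi)
    ((hδi.const_mul (-c + 2 * R * L * (C₁ * lam))).add
      (intervalIntegrable_const (c := (Kℓ + R * K) * (C₁ * lam) ^ 2)))
    ⟨hT.le, le_rfl⟩ hbound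
  rw [intervalIntegral.integral_add (hcz.sub hcx) hDi, hDint,
    intervalIntegral.integral_sub hcz hcx,
    intervalIntegral.integral_add (hδi.const_mul _) intervalIntegrable_const,
    intervalIntegral.integral_const_mul, intervalIntegral.integral_const, ← hlam] at hmain
  simp only [sub_zero, smul_eq_mul, add_zero] at hmain
  rw [cost, cost]
  calc _ ≤ _ := hmain
    _ = _ := by ring

/-! ### Mode schedules of switching controls -/

theorem single_one_injective {N : ℕ} :
    Function.Injective fun a : Fin N => (Pi.single a 1 : Fin N → ℝ) := fun a b h => by
  by_contra hne
  have := congrFun h a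
  simp [hne] at this

/-- A switching time must lie in `S`, so there are finitely many; half the least distance between
two of them separates all of them strictly. -/
theorem isNonChatteringControl_of_hasModeAt {N : ℕ} {T : ℝ} {w : ℝ → Fin N → ℝ} {S : Set ℝ}
    (hS : S.Finite) (h : ∀ t ∈ Ioo 0 T \ S, ∃ b, HasModeAt w t b)
    (h01 : ∀ t i, w t i = 0 ∨ w t i = 1) : IsNonChatteringControl T w := by
  refine ⟨⟨⟨S, hS, fun t ht => ?_⟩, ?_, fun t _ => h01 t⟩, ?_⟩
  · obtain ⟨b, hb⟩ := h t ht
    exact hb.mono fun s hs => hs.trans hb.eq.symm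
  · refine ae_of_forall_diff_finite hS fun t ht => ?_
    obtain ⟨b, hb⟩ := h t ht
    simp [hb.eq]
  · have hsub : switchingTimes T w ⊆ S := by
      rintro t ⟨ht, v, v', hne, hv, hv'⟩
      by_contra htS
      obtain ⟨b, hb⟩ := h t ⟨ht, htS⟩
      obtain ⟨s, hs⟩ := (hv.and (hb.filter_mono nhdsWithin_le_nhds)).exists
      obtain ⟨s', hs'⟩ := (hv'.and (hb.filter_mono nhdsWithin_le_nhds)).exists
      exact hne (hs.1.symm.trans (hs.2.trans (hs'.2.symm.trans hs'.1)))
    have hfin : ((switchingTimes T w).offDiag).Finite := (hS.subset hsub).offDiag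
    rcases (switchingTimes T w).offDiag.eq_empty_or_nonempty with he | hne
    · refine ⟨1, one_pos, fun s hs t ht hst => ?_⟩
      exact absurd (show (s, t) ∈ (switchingTimes T w).offDiag from ⟨hs, ht, hst⟩) (by simp [he])
    · obtain ⟨p, hp, hmin⟩ := hfin.exists_minimalFor (fun p : ℝ × ℝ => |p.1 - p.2|) _ hne
      have hp0 : 0 < |p.1 - p.2| := abs_pos.2 (sub_ne_zero.2 hp.2.2)
      refine ⟨|p.1 - p.2| / 2, by positivity, fun s hs t ht hst => ?_⟩
      have h1 : |p.1 - p.2| ≤ |s - t| := by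
        rcases le_total |p.1 - p.2| |s - t| with h | h
        · exact h
        · exact hmin (j := (s, t)) ⟨hs, ht, hst⟩ h
      linarith

theorem ordConnected_modeInterval {K : ℕ} (T : ℝ) (τ : Fin K → ℝ) (i : Fin (K + 1)) :
    (modeInterval T τ i).OrdConnected :=
  ⟨fun _ hx _ hy _ hz => ⟨⟨hx.1.1.trans_le hz.1, hz.2.trans_lt hy.1.2⟩,
    fun j hj => (hx.2.1 j hj).trans_le hz.1, fun j hj => hz.2.trans_lt (hy.2.2 j hj)⟩⟩

/-- Away from the genuine mode changes the mode is a locally constant function of time, hence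
constant on each interval between them. The main proof tests its hypothesis on types against this
schedule. -/
theorem IsSwitchingControl.exists_isSchedule {N : ℕ} {T : ℝ} (hT : 0 < T) {u : ℝ → Fin N → ℝ}
    (hu : IsSwitchingControl T u) :
    ∃ (K : ℕ) (σ : Fin (K + 1) → Fin N) (τ : Fin K → ℝ), IsSchedule T u σ τ := by
  obtain ⟨S, hS, hSu⟩ := hu.exists_hasModeAt
  have : Nonempty (Fin N) := by
    obtain ⟨t, ht⟩ := ((Ioo_infinite hT).sdiff hS).nonempty
    exact (hSu t ht).nonempty
  -- Punctured neighbourhoods ignore isolated exceptional values of `u`. This is what makes adjacent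
  -- modes distinct: equal modes on both sides of a time would keep it out of `D`.
  set D : Set ℝ := {t ∈ Ioo 0 T | ¬ ∃ a : Fin N, ∀ᶠ s in 𝓝[≠] t, u s = Pi.single a 1} with hD
  have hDfin : D.Finite := hS.subset fun t ht => by
    by_contra htS
    obtain ⟨a, ha⟩ := hSu t ⟨ht.1, htS⟩
    exact ht.2 ⟨a, ha.filter_mono nhdsWithin_le_nhds⟩
  have hmode : ∀ t ∈ Ioo 0 T \ D, ∃ a : Fin N, ∀ᶠ s in 𝓝[≠] t, u s = Pi.single a 1 :=
    fun t ht => by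
      by_contra h
      exact ht.2 ⟨ht.1, h⟩
  choose! m hm using hmode
  have huniq : ∀ t ∈ Ioo 0 T \ D, ∀ a, HasModeAt u t a → m t = a := fun t ht a ha => by
    obtain ⟨s, h1, h2⟩ := ((hm t ht).and (ha.filter_mono nhdsWithin_le_nhds)).exists
    exact single_one_injective (h1.symm.trans h2)
  have hmS : ∀ t ∈ (Ioo 0 T \ D) \ S, u t = Pi.single (m t) 1 := fun t ht => by
    obtain ⟨a, ha⟩ := hSu t ⟨ht.1.1, ht.2⟩
    rw [huniq t ht.1 a ha, ha.eq]
  have hmc : ContinuousOn m (Ioo 0 T \ D) := fun t ht => by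
    refine (continuousAt_const (y := m t)).continuousWithinAt.congr_of_eventuallyEq ?_ rfl
    have h1 := eventually_eventually_nhdsWithin.2 (hm t ht)
    rw [eventually_nhdsWithin_iff] at h1
    filter_upwards [self_mem_nhdsWithin, h1.filter_mono nhdsWithin_le_nhds] with y hy h2
    rcases eq_or_ne y t with rfl | hyt
    · rfl
    · have h3 := h2 hyt
      rw [isOpen_compl_singleton.nhdsWithin_eq hyt] at h3
      exact huniq y hy _ h3
  set τ : Fin hDfin.toFinset.card → ℝ :=
    ⇑(hDfin.toFinset.orderEmbOfFin rfl)
  have hτD : ∀ i, τ i ∈ D := fun i =>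
    hDfin.mem_toFinset.1 (Finset.orderEmbOfFin_mem _ rfl i)
  have hDτ : ∀ t ∈ D, ∃ i, τ i = t := fun t ht => by
    have : t ∈ range (hDfin.toFinset.orderEmbOfFin rfl) := by
      rw [Finset.range_orderEmbOfFin]; simpa using ht
    exact this
  have hτmono : StrictMono τ := OrderEmbedding.strictMono _
  have hint : ∀ i, modeInterval T τ i ⊆ Ioo 0 T \ D := fun i t ht => by
    refine ⟨ht.1, fun htD => ?_⟩
    obtain ⟨j, rfl⟩ := hDτ t htD
    rcases lt_or_ge j.castSucc i with h | h
    · exact lt_irrefl _ (ht.2.1 j h)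
    · exact lt_irrefl _ (ht.2.2 j h)
  have hconst : ∀ i, ∃ a, ∀ t ∈ modeInterval T τ i, m t = a := fun i => by
    rcases (modeInterval T τ i).eq_empty_or_nonempty with h | ⟨t₀, ht₀⟩
    · exact ⟨Classical.arbitrary _, by simp [h]⟩
    · exact ⟨m t₀, fun t ht => (ordConnected_modeInterval T τ i).isPreconnected.constant
        (hmc.mono (hint i)) ht ht₀⟩
  choose σ hσ using hconst
  refine ⟨_, σ, τ, hτmono, fun i => (hτD i).1, fun i heq => ?_, fun i => ?_⟩
  · refine (hτD i).2 ⟨σ i.castSucc, ?_⟩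
    have hSev : ∀ᶠ s in 𝓝[≠] τ i, s ∉ S := by
      rw [eventually_nhdsWithin_iff]
      filter_upwards [(hS.sdiff (t := {τ i})).isClosed.isOpen_compl.mem_nhds
        (by simp : τ i ∈ (S \ {τ i})ᶜ)] with s hs hne hsS
      exact hs ⟨hsS, hne⟩
    have hlt : ∀ᶠ s in 𝓝 (τ i), ∀ j, (j < i → τ j < s) ∧ (i < j → s < τ j) := by
      refine eventually_all.2 fun j => (?_ : ∀ᶠ s in 𝓝 (τ i), j < i → τ j < s).and ?_
      · by_cases hj : j < i
        · exact (lt_mem_nhds (hτmono hj)).mono fun s hs _ => hs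
        · exact Eventually.of_forall fun s h => absurd h hj
      · by_cases hj : i < j
        · exact (gt_mem_nhds (hτmono hj)).mono fun s hs _ => hs
        · exact Eventually.of_forall fun s h => absurd h hj
    filter_upwards [hSev, hlt.filter_mono nhdsWithin_le_nhds, self_mem_nhdsWithin,
      nhdsWithin_le_nhds (Ioo_mem_nhds (hτD i).1.1 (hτD i).1.2)] with s hsS hsj hne hsT
    rcases lt_or_gt_of_ne hne with hsi | hsi
    · have hmem : s ∈ modeInterval T τ i.castSucc := by
        refine ⟨hsT, fun j hj => (hsj j).1 (by simpa using hj), fun j hj => ?_⟩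
        rcases (show i ≤ j by simpa using hj).eq_or_lt with rfl | h
        · exact hsi
        · exact (hsj j).2 h
      rw [hmS s ⟨hint _ hmem, hsS⟩, hσ _ s hmem]
    · have hmem : s ∈ modeInterval T τ i.succ := by
        refine ⟨hsT, fun j hj => ?_, fun j hj => (hsj j).2 ?_⟩
        · rcases (show j ≤ i by
            rw [Fin.lt_def] at hj; rw [Fin.le_def]; simp at hj; omega).eq_or_lt with rfl | h
          · exact hsi
          · exact (hsj j).1 h
        · rw [Fin.le_def] at hj; rw [Fin.lt_def]; simp at hj; omega
      rw [hmS s ⟨hint _ hmem, hsS⟩, hσ _ s hmem, heq]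
  · have := ae_of_forall_diff_finite (T := T) hS
      (p := fun t => t ∈ modeInterval T τ i → u t = Pi.single (σ i) 1) fun t ht hti => by
        rw [hmS t ⟨hint i hti, ht.2⟩, hσ i t hti]
    exact this.mono fun t ht hti => ht (Ioo_subset_Icc_self hti.1) hti

theorem IsSchedule.congr_ae {N K : ℕ} {T : ℝ} {u w : ℝ → Fin N → ℝ} {σ : Fin (K + 1) → Fin N}
    {τ : Fin K → ℝ} (h : IsSchedule T u σ τ) (hwu : ∀ᵐ t : ℝ, t ∈ Icc 0 T → w t = u t) :
    IsSchedule T w σ τ :=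
  ⟨h.strictMono, h.mem_Ioo, h.modes_ne, fun i => by
    filter_upwards [h.control_eq i, hwu] with t h1 h2 ht
    rw [h2 (Ioo_subset_Icc_self ht.1), h1 ht]⟩

/-! ### The max-projection of `u - γ d` -/

/-- By Rolle, two points of a level set have a critical point between them. Noncritical points of
the level set are thus told apart by which of the finitely many critical points precede them. -/
theorem finite_level_set {T : ℝ} {g : ℝ → ℝ}
    (hg : {t ∈ Icc 0 T | ¬ DifferentiableAt ℝ g t ∨ deriv g t = 0}.Finite) (c : ℝ) :
    {t ∈ Icc 0 T | g t = c}.Finite := by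
  set C := {t ∈ Icc 0 T | ¬ DifferentiableAt ℝ g t ∨ deriv g t = 0} with hC
  suffices h : ({t ∈ Icc 0 T | g t = c} \ C).Finite from
    (h.union hg).subset fun t ht => by
      by_cases htC : t ∈ C
      · exact Or.inr htC
      · exact Or.inl ⟨ht, htC⟩
  have key : ∀ s ∈ {t ∈ Icc 0 T | g t = c} \ C, ∀ t ∈ {t ∈ Icc 0 T | g t = c} \ C, s < t →
      C ∩ Iio s ≠ C ∩ Iio t := by
    rintro s ⟨⟨hsT, hsc⟩, hsC⟩ t ⟨⟨htT, htc⟩, htC⟩ hst heq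
    obtain ⟨r, hr, hrC⟩ : ∃ r ∈ Icc s t, r ∈ C := by
      by_contra! hno
      have hd : ∀ r ∈ Icc s t, DifferentiableAt ℝ g r := fun r hr => by
        by_contra hnd
        exact hno r hr ⟨⟨hsT.1.trans hr.1, hr.2.trans htT.2⟩, Or.inl hnd⟩
      obtain ⟨r, hr, hr0⟩ := exists_deriv_eq_zero hst
        (fun r hr => (hd r hr).continuousAt.continuousWithinAt) (hsc.trans htc.symm)
      exact hno r (Ioo_subset_Icc_self hr)
        ⟨⟨hsT.1.trans hr.1.le, hr.2.le.trans htT.2⟩, Or.inr hr0⟩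
    have hrt : r < t := lt_of_le_of_ne hr.2 fun h => htC (h ▸ hrC)
    have : r ∈ C ∩ Iio s := heq ▸ ⟨hrC, hrt⟩
    exact absurd this.2 (not_lt.2 hr.1)
  refine Finite.of_injOn (f := fun t => C ∩ Iio t) (t := {b | b ⊆ C})
    (fun t _ => inter_subset_left) (fun s hs t ht heq => ?_) hg.finite_subsets
  rcases lt_trichotomy s t with h | h | h
  · exact absurd heq (key s hs t ht h)
  · exact h
  · exact absurd heq.symm (key t ht s hs h)

theorem maxMap_eq_single {N : ℕ} {v : Fin N → ℝ} {b : Fin N} (h : ∀ j, j ≠ b → v j < v b) :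
    maxMap v = Pi.single b 1 := by
  funext i
  rcases eq_or_ne i b with rfl | hi
  · rw [Pi.single_eq_same]
    refine Finset.prod_eq_one fun j hj => ?_
    rw [step, if_pos (sub_nonneg.2 (h j (Finset.ne_of_mem_erase hj)).le)]
  · rw [Pi.single_eq_of_ne hi]
    refine Finset.prod_eq_zero (i := b) (by simp [hi.symm]) ?_
    rw [step, if_neg (by have := h i hi; linarith)]

theorem maxMap_zero_or_one {N : ℕ} (v : Fin N → ℝ) (i : Fin N) :
    maxMap v i = 0 ∨ maxMap v i = 1 := by
  rw [maxMap]
  refine Finset.prod_induction _ (fun r => r = 0 ∨ r = 1) ?_ (Or.inr rfl) fun j _ => ?_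
  · rintro a b (rfl | rfl) (rfl | rfl) <;> simp
  · rw [step]; split_ifs <;> simp

theorem HasFinitelyManyCriticalPoints.of_neg {N : ℕ} {T : ℝ} {d : ℝ → Fin N → ℝ}
    (h : HasFinitelyManyCriticalPoints T (-d)) : HasFinitelyManyCriticalPoints T d :=
  fun i j hij => by
    have := h j i hij.symm
    simpa only [Pi.neg_apply, neg_sub_neg] using this

/-- At all but finitely many times both `u` and `Q(u - γ d)` have a mode, and the mode of the
latter is the strict maximizer of `u - γ d`. -/
theorem exists_hasModeAt_updatedControl {N : ℕ} {T : ℝ} {u d : ℝ → Fin N → ℝ}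
    (hu : IsSwitchingControl T u) (hd : HasFinitelyManyCriticalPoints T d) {γ : ℝ} (hγ : 0 < γ) :
    ∃ S : Set ℝ, S.Finite ∧ ∀ t ∈ Ioo 0 T \ S, ∃ a b, HasModeAt u t a ∧
      HasModeAt (updatedControl u d γ) t b ∧
      ∀ j, j ≠ b → u t j - γ * d t j < u t b - γ * d t b := by
  obtain ⟨S, hS, hSu⟩ := hu.exists_hasModeAt
  let C : Fin N → Fin N → Set ℝ := fun i j => {t | i ≠ j ∧ t ∈ Icc 0 T ∧
    (¬ DifferentiableAt ℝ (fun s => d s i - d s j) t ∨ deriv (fun s => d s i - d s j) t = 0)}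
  -- While `u = e_a`, a tie between the entries `i` and `j` of `u - γ d` puts `t` in a level set of
  -- `d_i - d_j`, which is finite.
  let V : Fin N → Fin N → Fin N → Set ℝ := fun a i j => {t | i ≠ j ∧ t ∈ Icc 0 T ∧
    d t i - d t j = ((Pi.single a 1 : Fin N → ℝ) i - (Pi.single a 1 : Fin N → ℝ) j) / γ}
  have hC : ∀ i j, (C i j).Finite := fun i j => by
    by_cases hij : i = j
    · simp [C, hij]
    · exact (hd i j hij).subset fun t ht => ht.2
  have hV : ∀ a i j, (V a i j).Finite := fun a i j => by
    by_cases hij : i = j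
    · simp [V, hij]
    · exact (finite_level_set (hd i j hij) _).subset fun t ht => ht.2
  refine ⟨S ∪ ((⋃ i, ⋃ j, C i j) ∪ ⋃ a, ⋃ i, ⋃ j, V a i j), hS.union ((finite_iUnion fun i =>
    finite_iUnion fun j => hC i j).union (finite_iUnion fun a => finite_iUnion fun i =>
    finite_iUnion fun j => hV a i j)), fun t ht => ?_⟩
  obtain ⟨htT, ht⟩ := ht
  simp only [mem_union, mem_iUnion, not_or, not_exists] at ht
  obtain ⟨htS, htC, htV⟩ := ht
  obtain ⟨a, ha⟩ := hSu t ⟨htT, htS⟩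
  have hcont : ∀ i j, ContinuousAt (fun s => d s i - d s j) t := fun i j => by
    by_cases hij : i = j
    · simpa [hij] using continuousAt_const
    · refine DifferentiableAt.continuousAt (𝕜 := ℝ) ?_
      by_contra h
      exact htC i j ⟨hij, Ioo_subset_Icc_self htT, Or.inl h⟩
  have : Nonempty (Fin N) := ⟨a⟩
  obtain ⟨b, hb⟩ := Finite.exists_max fun i => u t i - γ * d t i
  have hlt : ∀ j, j ≠ b → u t j - γ * d t j < u t b - γ * d t b := fun j hj => by
    refine lt_of_le_of_ne (hb j) fun heq => htV a j b ⟨hj, Ioo_subset_Icc_self htT, ?_⟩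
    rw [← ha.eq, eq_div_iff hγ.ne']
    linarith
  refine ⟨a, b, ha, ?_, hlt⟩
  -- The strict maximizer persists near `t`; only the differences `d_b - d_j` are known to be
  -- continuous there, and they suffice.
  have hev : ∀ᶠ s in 𝓝 t, ∀ j, j ≠ b →
      0 < ((Pi.single a 1 : Fin N → ℝ) b - (Pi.single a 1 : Fin N → ℝ) j) -
        γ * (d s b - d s j) := by
    refine eventually_all.2 fun j => ?_
    by_cases hj : j = b
    · exact Eventually.of_forall fun s h => absurd hj h
    · refine ((continuousAt_const.sub (continuousAt_const.mul (hcont b j))).eventually_const_lt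
        ?_).mono fun s hs _ => hs
      have := hlt j hj
      rw [ha.eq] at this
      simp only [Pi.sub_apply, Pi.mul_apply]
      linarith
  filter_upwards [hev, ha] with s hs hsa
  refine maxMap_eq_single fun j hj => ?_
  have := hs j hj
  simp only [Pi.sub_apply, Pi.smul_apply, smul_eq_mul, hsa]
  linarith

theorem isNonChatteringControl_updatedControl {N : ℕ} {T : ℝ} {u d : ℝ → Fin N → ℝ}
    (hu : IsSwitchingControl T u) (hd : HasFinitelyManyCriticalPoints T d) {γ : ℝ} (hγ : 0 < γ) :
    IsNonChatteringControl T (updatedControl u d γ) := by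
  obtain ⟨S, hS, h⟩ := exists_hasModeAt_updatedControl hu hd hγ
  exact isNonChatteringControl_of_hasModeAt hS
    (fun t ht => let ⟨_, b, _, hb, _⟩ := h t ht; ⟨b, hb⟩) fun t => maxMap_zero_or_one _

/-- Where `d_i > -1/γ` for all modes `i`, the update does not change the control. -/
theorem updatedControl_eq_of_forall_lt {N : ℕ} {u d : ℝ → Fin N → ℝ} {γ t : ℝ} (hγ : 0 < γ)
    {a : Fin N} (ha : u t = Pi.single a 1) (hda : d t a = 0) (h : ∀ i, -1 / γ < d t i) :
    updatedControl u d γ t = u t := by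
  rw [ha]
  refine maxMap_eq_single fun j hj => ?_
  have := h j
  rw [div_lt_iff₀ hγ] at this
  simp only [Pi.sub_apply, Pi.smul_apply, smul_eq_mul, ha, hda, Pi.single_eq_same,
    Pi.single_eq_of_ne hj]
  linarith

/-- The real `sInf` of a set unbounded below is `0`, so a negative `theta` already forces the values
of `d` to be bounded below. -/
theorem theta_le {N : ℕ} {T : ℝ} {d : ℝ → Fin N → ℝ} (hθ : theta T d < 0) {t : ℝ}
    (ht : t ∈ Icc 0 T) (a : Fin N) : theta T d ≤ d t a := by
  refine csInf_le ?_ ⟨a, t, ht, rfl⟩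
  by_contra h
  exact hθ.ne (Real.sInf_of_not_bddBelow h)

theorem insertionGradient_eq {n N : ℕ} {f : Fin N → State n → State n} {x ρ : ℝ → State n}
    {u : ℝ → Fin N → ℝ} {t : ℝ} {a : Fin N} (ha : u t = Pi.single a 1) (b : Fin N) :
    insertionGradient f x u ρ t b = inner ℝ (ρ t) (f b (x t) - f a (x t)) := by
  rw [insertionGradient, ha, vectorField_single]

/-- The length of time for which `Q(u - γ d)` differs from `u` tends to `0` as `γ ↓ γ₀`. -/
theorem tendsto_integral_updatedControl_ne {N : ℕ} {T : ℝ} (hT : 0 < T) {u d : ℝ → Fin N → ℝ}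
    (hu : IsSwitchingControl T u) (hd : HasFinitelyManyCriticalPoints T d)
    (hda : ∀ t a, u t = Pi.single a 1 → d t a = 0) (hθ : theta T d < 0) :
    Tendsto (fun γ => ∫ t in (0 : ℝ)..T, if updatedControl u d γ t = u t then (0 : ℝ) else 1)
      (𝓝[>] gammaZero T d) (𝓝 0) := by
  have hγ₀ : 0 < gammaZero T d := div_pos_of_neg_of_neg (by norm_num) hθ
  have hγθ : -1 / gammaZero T d = theta T d := by
    rw [gammaZero]; field_simp
  obtain ⟨S, hS, hSu⟩ := hu.exists_hasModeAt
  let V : Fin N → Fin N → Set ℝ :=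
    fun i j => {t | i ≠ j ∧ t ∈ Icc 0 T ∧ d t i - d t j = theta T d}
  have hV : (⋃ i, ⋃ j, V i j).Finite := finite_iUnion fun i => finite_iUnion fun j => by
    by_cases hij : i = j
    · simp [V, hij]
    · exact (finite_level_set (hd i j hij) _).subset fun t ht => ht.2
  have hae := ae_of_forall_diff_finite (T := T) (hS.union hV)
    (p := fun t => ∃ a, u t = Pi.single a 1 ∧ ∀ i, theta T d < d t i) fun t ht => by
    obtain ⟨a, ha⟩ := hSu t ⟨ht.1, fun h => ht.2 (Or.inl h)⟩
    have hta := hda t a ha.eq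
    refine ⟨a, ha.eq, fun i => ?_⟩
    rcases eq_or_ne i a with rfl | hia
    · rwa [hta]
    · refine lt_of_le_of_ne (theta_le hθ (Ioo_subset_Icc_self ht.1) i) fun h => ht.2 (Or.inr ?_)
      exact mem_iUnion₂.2 ⟨i, a, hia, Ioo_subset_Icc_self ht.1, by rw [hta, sub_zero, h]⟩
  -- At almost every time all `d_i` exceed `θ`, the limit of `-1 / γ`, so the integrand is
  -- eventually `0` there.
  have key := intervalIntegral.tendsto_integral_filter_of_dominated_convergence
    (μ := volume) (a := 0) (b := T) (l := 𝓝[>] gammaZero T d)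
    (F := fun γ t => if updatedControl u d γ t = u t then (0 : ℝ) else 1) (f := fun _ => 0)
    (fun _ => 1) ?_ ?_ intervalIntegrable_const ?_
  · simpa using key
  · filter_upwards [self_mem_nhdsWithin] with γ hγ
    have hw := isNonChatteringControl_updatedControl hu hd (hγ₀.trans hγ)
    have := (intervalIntegrable_of_isPiecewiseConstant hT (C := 1)
      (hw.1.piecewiseConstant.comp₂ hu.piecewiseConstant fun a b => if a = b then (0 : ℝ) else 1)
      fun t _ => by split_ifs <;> simp).aestronglyMeasurable
    rwa [uIoc_of_le hT.le]
  · exact Eventually.of_forall fun γ => ae_of_all _ fun t _ => by split_ifs <;> simp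
  · filter_upwards [hae] with t ht htT
    rw [uIoc_of_le hT.le] at htT
    obtain ⟨a, ha, hlt⟩ := ht (Ioc_subset_Icc_self htT)
    have hlim : Tendsto (fun γ : ℝ => -1 / γ) (𝓝[>] gammaZero T d) (𝓝 (theta T d)) := by
      rw [← hγθ]
      exact (tendsto_const_nhds.div tendsto_id hγ₀.ne').mono_left nhdsWithin_le_nhds
    have hev : ∀ᶠ γ in 𝓝[>] gammaZero T d, ∀ i, -1 / γ < d t i :=
      eventually_all.2 fun i => hlim.eventually_lt_const (hlt i)
    refine tendsto_const_nhds.congr' ?_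
    filter_upwards [hev, self_mem_nhdsWithin] with γ h1 h2
    rw [if_pos (updatedControl_eq_of_forall_lt (hγ₀.trans h2) ha (hda t a ha) h1)]

/-- If `Q(u - γ d)` agrees with `u` almost everywhere for one `γ`, then so it does for smaller
step sizes. -/
theorem updatedControl_ae_eq_of_lt {N : ℕ} {T : ℝ} {u d : ℝ → Fin N → ℝ}
    (hu : IsSwitchingControl T u) (hd : HasFinitelyManyCriticalPoints T d)
    (hda : ∀ t a, u t = Pi.single a 1 → d t a = 0) {γ γ' : ℝ} (hγ : 0 < γ) (hγγ' : γ < γ')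
    (h : ∀ᵐ t : ℝ, t ∈ Icc 0 T → updatedControl u d γ' t = u t) :
    ∀ᵐ t : ℝ, t ∈ Icc 0 T → updatedControl u d γ t = u t := by
  obtain ⟨S, hS, hSu⟩ := exists_hasModeAt_updatedControl hu hd (hγ.trans hγγ')
  have hae := ae_of_forall_diff_finite (T := T) hS
    (p := fun t => updatedControl u d γ' t = u t → updatedControl u d γ t = u t)
    fun t ht heq => by
    obtain ⟨a, b, ha, hb, hlt⟩ := hSu t ht
    have hta := hda t a ha.eq
    obtain rfl : b = a := single_one_injective (hb.eq.symm.trans (heq.trans ha.eq))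
    refine updatedControl_eq_of_forall_lt hγ ha.eq hta fun i => ?_
    rw [div_lt_iff₀ hγ]
    rcases eq_or_ne i b with rfl | hi
    · rw [hta]; norm_num
    · have h1 := hlt i hi
      rw [ha.eq, Pi.single_eq_of_ne hi, Pi.single_eq_same, hta] at h1
      rcases le_or_gt 0 (d t i) with h2 | h2
      · have := mul_nonneg h2 hγ.le
        linarith
      · nlinarith
  filter_upwards [h, hae] with t h1 h2 ht using h2 ht (h1 ht)

/-- Where the update `w` changes the control, `⟪ρ, F(x, w) - F(x, u)⟫` is at most `-1/γ`. -/
theorem inner_vectorField_updatedControl_sub_le {n N : ℕ} {T : ℝ}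
    {f : Fin N → State n → State n} {x ρ : ℝ → State n} {u d : ℝ → Fin N → ℝ}
    (hu : IsSwitchingControl T u) (hd : HasFinitelyManyCriticalPoints T d)
    (hdef : d = insertionGradient f x u ρ) {γ : ℝ} (hγ : 0 < γ) :
    ∀ᵐ t : ℝ, t ∈ Icc 0 T → inner ℝ (ρ t) (vectorField f (x t) (updatedControl u d γ t) -
      vectorField f (x t) (u t)) ≤
        -(1 / γ) * if updatedControl u d γ t = u t then (0 : ℝ) else 1 := by
  obtain ⟨S, hS, hSu⟩ := exists_hasModeAt_updatedControl hu hd hγ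
  refine ae_of_forall_diff_finite hS fun t ht => ?_
  obtain ⟨a, b, ha, hb, hlt⟩ := hSu t ht
  split_ifs with heq
  · simp [heq]
  · have hba : b ≠ a := fun h => heq (by rw [ha.eq, hb.eq, h])
    -- Mode `b` beats mode `a`, whose entry is `1 - γ * 0`, so `-γ * d t b > 1`.
    have h1 := hlt a hba.symm
    have hta : d t a = 0 := by rw [hdef, insertionGradient_eq ha.eq]; simp
    rw [ha.eq, Pi.single_eq_of_ne hba, Pi.single_eq_same, hta] at h1
    rw [hb.eq, ha.eq, vectorField_single, vectorField_single, ← insertionGradient_eq ha.eq,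
      ← hdef, mul_one, ← neg_div, le_div_iff₀ hγ]
    linarith

theorem ae_eq_of_integral_ne_eq_zero {N : ℕ} {T : ℝ} (hT : 0 < T) {u w : ℝ → Fin N → ℝ}
    (hu : IsSwitchingControl T u) (hw : IsSwitchingControl T w)
    (h : (∫ t in (0 : ℝ)..T, if w t = u t then (0 : ℝ) else 1) = 0) :
    ∀ᵐ t : ℝ, t ∈ Icc 0 T → w t = u t := by
  have hi := intervalIntegrable_of_isPiecewiseConstant hT (C := 1)
    (hw.piecewiseConstant.comp₂ hu.piecewiseConstant fun a b => if a = b then (0 : ℝ) else 1)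
    fun t _ => by split_ifs <;> simp
  rw [intervalIntegral.integral_eq_zero_iff_of_le_of_nonneg_ae hT.le
    (ae_of_all _ fun t => by simp only [Pi.zero_apply]; split_ifs <;> simp) hi,
    EventuallyEq, ae_restrict_iff' measurableSet_Ioc] at h
  have h0 : ∀ᵐ t : ℝ, t ≠ 0 := by simp [ae_iff]
  filter_upwards [h, h0] with t ht ht0 htT
  by_contra hne
  have := ht ⟨lt_of_le_of_ne htT.1 ht0.symm, htT.2⟩
  simp [hne] at this

theorem switchingType_const {N : ℕ} (d : ℝ → Fin N → ℝ) (γ₀ c : ℝ) (a b : Fin N) :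
    switchingType d γ₀ (fun _ => c) a b = 0 :=
  if_pos ⟨1, one_pos, c, fun _ _ => rfl⟩

end SwitchedSystem

theorem mainTheorem2 {n N : ℕ} (f : Fin N → State n → State n) (ℓ : State n → ℝ)
    (x0 : State n) (T : ℝ) (hT : 0 < T)
    (hf : ∀ i, IsC2Bounded (f i)) (hℓ : IsC2Bounded ℓ)
    (x : ℝ → State n) (u : ℝ → Fin N → ℝ) (hxu : IsFeasible f x0 T x u)
    (ρ : ℝ → State n) (hρ : IsAdjoint f ℓ T x u ρ)
    (d : ℝ → Fin N → ℝ) (hd : d = insertionGradient f x u ρ)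
    (hcrit : HasFinitelyManyCriticalPoints T (-d))
    (hθ : theta T d < 0)
    (hm : ∀ (K : ℕ) (σ : Fin (K + 1) → Fin N) (τ : ℝ → Fin K → ℝ),
      IsScheduleAfter T u d (gammaZero T d) σ τ →
        greatestType d (gammaZero T d) σ τ = 1 ∨ greatestType d (gammaZero T d) σ τ = 2) :
    IsDescentDirection f ℓ x0 T x u d := by
  have hu := hxu.control.1
  have hcrit' := hcrit.of_neg
  have hda : ∀ t a, u t = Pi.single a 1 → d t a = 0 := fun t a ha => by
    rw [hd, insertionGradient_eq ha]; simp
  set γ₀ := gammaZero T d with hγ₀def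
  have hγ₀ : 0 < γ₀ := div_pos_of_neg_of_neg (by norm_num) hθ
  set lam : ℝ → ℝ := fun γ =>
    ∫ t in (0 : ℝ)..T, if updatedControl u d γ t = u t then (0 : ℝ) else 1 with hlam
  have hlim : Tendsto lam (𝓝[>] γ₀) (𝓝 0) :=
    tendsto_integral_updatedControl_ne hT hu hcrit' hda hθ
  have hnc : ∀ γ, γ₀ < γ → IsNonChatteringControl T (updatedControl u d γ) := fun γ hγ =>
    isNonChatteringControl_updatedControl hu hcrit' (hγ₀.trans hγ)
  -- a vanishing change of the control would give all switching times type `0`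
  have hpos : ∀ γ, γ₀ < γ → 0 < lam γ := by
    intro γ hγ
    have h0 : 0 ≤ lam γ := intervalIntegral.integral_nonneg hT.le fun t _ => by
      split_ifs <;> simp
    refine lt_of_le_of_ne h0 fun hzero => ?_
    have hae := ae_eq_of_integral_ne_eq_zero hT hu (hnc γ hγ).1 hzero.symm
    obtain ⟨K, σ, τ, hsch⟩ := hu.exists_isSchedule hT
    -- The updates agree with `u` almost everywhere for all step sizes in `(γ₀, γ)`, so the fixed
    -- schedule of `u` is theirs.
    have hafter : IsScheduleAfter T u d γ₀ σ fun _ => τ :=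
      ⟨γ - γ₀, sub_pos.2 hγ, fun γ' hγ' => hsch.congr_ae
        (updatedControl_ae_eq_of_lt hu hcrit' hda (hγ₀.trans hγ'.1)
          (by have := hγ'.2; linarith) hae)⟩
    have htype : greatestType d γ₀ σ (fun _ => τ) = 0 := by
      simp [greatestType, switchingType_const]
    rcases hm K σ _ hafter with h | h <;> simp [htype] at h
  obtain ⟨ε, C, hε, hC, hest⟩ := hxu.exists_cost_sub_le hT hf hℓ hρ
  -- A lower bound for `1 / γ` that does not depend on `γ < 2 * γ₀`; then `lam γ < c / (C + 1)`
  -- gives `C * lam γ < 1 / γ`, so the linear gain beats the quadratic error.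
  set c : ℝ := 1 / (2 * γ₀) with hc
  have hc0 : 0 < c := by positivity
  have hsmall : ∀ᶠ γ in 𝓝[>] γ₀, lam γ < min ε (c / (C + 1)) :=
    hlim.eventually_lt_const (lt_min hε (by positivity))
  obtain ⟨γ₁, hγ₁, hsub⟩ := mem_nhdsGT_iff_exists_Ioo_subset.1
    (hsmall.and (mem_nhdsWithin_of_mem_nhds (Iio_mem_nhds (by linarith : γ₀ < 2 * γ₀))))
  refine ⟨γ₁ - γ₀, sub_pos.2 hγ₁, fun γ hγ => ?_⟩
  rw [← hγ₀def, add_sub_cancel] at hγ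
  obtain ⟨hlt, hγ2⟩ := hsub hγ
  have hγ0 : 0 < γ := hγ₀.trans hγ.1
  obtain ⟨⟨z₀, hz₀⟩, hcost⟩ := hest _ (hnc γ hγ.1) (hlt.le.trans (min_le_left _ _))
  refine ⟨⟨z₀, _, rfl, hz₀⟩, ?_⟩
  rintro z w ⟨rfl, hz⟩
  have hdec := hcost z hz (1 / γ)
    (inner_vectorField_updatedControl_sub_le hu hcrit' hd hγ0)
  have hp := hpos γ hγ.1
  have hlt2 : lam γ * (C + 1) < c :=
    (lt_div_iff₀ (by positivity)).1 (hlt.trans_le (min_le_right _ _))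
  have hcγ : c ≤ 1 / γ := by
    rw [hc]
    exact one_div_le_one_div_of_le hγ0 (le_of_lt hγ2)
  change _ ≤ -(1 / γ) * lam γ + C * lam γ ^ 2 at hdec
  have h1 : lam γ * (C * lam γ - 1 / γ) < 0 :=
    mul_neg_of_pos_of_neg hp (by nlinarith)
  linarith [h1]
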